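/- Let $R=k[x_1,\dots,x_n]$ be a polynomial ring over a field $k$, let $I\subsetneq R$ be a proper ideal (not necessarily homogeneous), and let $>_1$ be a term order on $R$. For an ideal $J$ and a term order $>$, $\mathrm{in}_>(J)$ denotes the ideal generated by the leading terms of the elements of $J$; for a monomial ideal $J$ and a variable $x$, $d_x(J)$ denotes the largest exponent of $x$ in a minimal monomial generator of $J$. Let $q\ge 0$, $t_1,\dots,t_q\ge 0$, and let $\{b_{i,j}\mid 1\le i\le q,\ 0\le j\le t_i\}$ be pairwise distinct variables of $R$ such that (1) $d_{b_{i,j}}(\mathrm{in}_{>_1}(I))\le 1$ for all $1\le i\le q$ and $1\le j\le t_i$; and (2) for each $1\le i\le q$, every minimal monomial generator of $\mathrm{in}_{>_1}(I)$ that is divisible by $b_{i,0}$ is divisible by $b_{i,j}$ for some $1\le j\le t_i$. Put $f_i=\sum_{j=0}^{t_i} b_{i,j}$ for $1\le i\le q$. Then, for all term orders $>_2,\dots,>_q$ on $R$ such that $b_{i,0}>_{i+1}b_{i,j}$ for all $1\le i\le q-1$ and $1\le j\le t_i$, the sequence $f_1,\dots,f_q$ is an initially regular sequence on $R/I$ with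 respect to $>_1,\dots,>_q$; that is, with $I_1=\mathrm{in}_{>_1}(I)$ and $I_i=\mathrm{in}_{>_i}(I_{i-1}+(f_{i-1}))$ for $2\le i\le q$, every $f_i$ is a nonconstant polynomial that is a regular element on $R/I_i$, i.e. a nonzerodivisor on $R/I_i$ with $I_i+(f_i)\ne R$. In particular, $\operatorname{depth} R/I\ge q$, where $\operatorname{depth} R/I$ is the smallest integer $d$ such that $\mathrm{Ext}^d_R(R/\mathfrak m,R/I)\ne 0$ for some maximal ideal $\mathfrak m$ of $R$ (for homogeneous $I$ this is the usual depth with respect to the homogeneous maximal ideal). -/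

import Mathlib

open scoped MonomialOrder

namespace InitReg

section InitialIdeals

variable {σ k : Type*} [Field k]

/-- The initial ideal `ini_>(I)`: the ideal generated by the leading terms of the elements of `I`. -/
noncomputable def ini (ord : MonomialOrder σ) (I : Ideal (MvPolynomial σ k)) :
    Ideal (MvPolynomial σ k) :=
  Ideal.span (ord.leadingTerm '' (I : Set (MvPolynomial σ k)))

/-- The exponent vectors of the monomials of `J` that are minimal for divisibility. If `J` is a
monomial ideal, these are the exponents of its minimal monomial generators. -/
def minGens (J : Ideal (MvPolynomial σ k)) : Set (σ →₀ ℕ) :=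
  {a | Minimal (fun c : σ →₀ ℕ => MvPolynomial.monomial c (1 : k) ∈ J) a}

/-- `d_x(J)`: the largest exponent of the variable `x` in a minimal monomial generator of `J`
(a supremum in `ℕ∞`, so that no junk value can occur; it is `0` if `J = 0`). -/
noncomputable def varDegree (x : σ) (J : Ideal (MvPolynomial σ k)) : ℕ∞ :=
  ⨆ a ∈ minGens J, (a x : ℕ∞)

/-- The ideals of the definition of an initially regular sequence, numbered from `0`:
`I_0 = ini_{>_0}(I)` and `I_{i+1} = ini_{>_{i+1}}(I_i, f_i)`. -/
noncomputable def iniChain {q : ℕ} (ord : Fin q → MonomialOrder σ)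
    (f : Fin q → MvPolynomial σ k) (I : Ideal (MvPolynomial σ k)) :
    (i : ℕ) → i < q → Ideal (MvPolynomial σ k)
  | 0, h => ini (ord ⟨0, h⟩) I
  | i + 1, h =>
      ini (ord ⟨i + 1, h⟩)
        (iniChain ord f I i (Nat.lt_of_succ_lt h) ⊔ Ideal.span {f ⟨i, Nat.lt_of_succ_lt h⟩})

/-- `f` is a regular element on `R/J`: a nonzerodivisor on `R/J` with `(R/J)/f(R/J) ≠ 0`. -/
def IsRegularElementOn (f : MvPolynomial σ k) (J : Ideal (MvPolynomial σ k)) : Prop :=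
  IsSMulRegular (MvPolynomial σ k ⧸ J) f ∧ J ⊔ Ideal.span {f} ≠ ⊤

/-- `f_0, …, f_{q-1}` is an initially regular sequence on `R/I` with respect to the term orders
`>_0, …, >_{q-1}`: `I` is proper, every `f_i` is nonconstant and is regular on `R/I_i`. -/
def IsInitiallyRegular {q : ℕ} (ord : Fin q → MonomialOrder σ)
    (f : Fin q → MvPolynomial σ k) (I : Ideal (MvPolynomial σ k)) : Prop :=
  I ≠ ⊤ ∧ ∀ i : Fin q,
    f i ∉ Set.range (MvPolynomial.C : k → MvPolynomial σ k) ∧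
      IsRegularElementOn (f i) (iniChain ord f I i i.isLt)

end InitialIdeals

section Depth

universe u

/-- The depth of `M` at an ideal `𝔪`: `min {d | Ext^d_A(A/𝔪, M) ≠ 0}`, which is `⊤` if all these
`Ext` groups vanish (for finite `M` over a noetherian ring: if `𝔪 M = M`). -/
noncomputable def depthAt {A : Type u} [CommRing A] (𝔪 : Ideal A) (M : Type u)
    [AddCommGroup M] [Module A M] : ℕ∞ :=
  ⨅ d ∈ {d : ℕ | Nontrivial
    (CategoryTheory.Abelian.Ext.{u} (ModuleCat.of A (A ⧸ 𝔪)) (ModuleCat.of A M) d)}, (d : ℕ∞)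

/-- The depth of `M`, as the minimum of the depths at all maximal ideals. For a nonzero finite
module `M` over a polynomial ring `A` in `n` variables over a field it equals `n - pd M`, and for
a graded `M` it is the depth at the homogeneous maximal ideal. -/
noncomputable def depth (A : Type u) [CommRing A] (M : Type u)
    [AddCommGroup M] [Module A M] : ℕ∞ :=
  ⨅ 𝔪 : MaximalSpectrum A, depthAt 𝔪.asIdeal M

end Depth

end InitReg

/-! Call a variable x with a set S of variables adapted to a monomial ideal J if the minimal
generators of J have degree at most one in each variable of S, and those divisible by x are
divisible by some variable of S. By hypothesis every group b_{i,0}; b_{i,1}, …, b_{i,t_i} is adapted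
to in(I). Two independent arguments start from this.

Regularity. If (x; S) is adapted to J, then x + ∑ S is a nonzerodivisor modulo J
(`mem_of_sum_X_mul_mem`): look at monomials of highest degree in one y ∈ S at a time. Adaptedness
passes from J to in(J + (F)), for any term order, when F is free of the variables of the group
(`Adapted.ini_sup_span`): it is a closure property under replacing exponents in these variables, and
each replacement extends to a linear map that commutes with multiplication by F and shifts all
surviving exponents by the same amount, hence respects leading monomials. The groups are disjoint,
so f_1, …, f_{i-1} do not disturb the i-th group.

Depth. The bound is proved directly from in(I). Splitting off one variable at a time orders monomial
generators of in(I) so that each successive colon ideal is generated by fewer than n - q variables;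
every group saves one variable (`hasLinearQuotients_of_adapted`). Lift these generators to I. As in
Schreyer's theorem, the leading terms of their syzygies are explicit, and they again have such an
order with one variable fewer (`LeadFun.LinearQuotients.syzygies`), so the syzygies vanish after n -
q steps. Since Ext^d(R/m, R) = 0 for d < n, dimension shifting gives Ext^d(R/m, I) = 0 for d ≤ q,
and hence Ext^d(R/m, R/I) = 0 for d < q. -/

namespace InitReg

/-! ### Initial ideals and monomial ideals -/

section MonomialIdeals

open MvPolynomial

variable {σ k : Type*} [Field k]

/-- An ideal that contains, with every polynomial, all the monomials occurring in it. -/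
def IsMonomialIdeal (J : Ideal (MvPolynomial σ k)) : Prop :=
  ∀ p ∈ J, ∀ a ∈ p.support, monomial a (1 : k) ∈ J

theorem mem_of_monomials_mem {J : Ideal (MvPolynomial σ k)} {p : MvPolynomial σ k}
    (h : ∀ a ∈ p.support, monomial a (1 : k) ∈ J) : p ∈ J := by
  rw [← support_sum_monomial_coeff p]
  refine J.sum_mem fun a ha => ?_
  have : monomial a (coeff a p) = C (coeff a p) * monomial a 1 := by
    rw [C_mul_monomial, mul_one]
  rw [this]
  exact J.mul_mem_left _ (h a ha)

theorem monomial_mem_of_le {J : Ideal (MvPolynomial σ k)} {a c : σ →₀ ℕ} (hac : a ≤ c)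
    (ha : monomial a (1 : k) ∈ J) : monomial c (1 : k) ∈ J := by
  have : monomial c (1 : k) = monomial (c - a) 1 * monomial a 1 := by
    rw [monomial_mul, tsub_add_cancel_of_le hac, one_mul]
  rw [this]
  exact J.mul_mem_left _ ha

theorem mem_ini_iff {ord : MonomialOrder σ} {I : Ideal (MvPolynomial σ k)}
    {p : MvPolynomial σ k} :
    p ∈ ini ord I ↔ ∀ a ∈ p.support, ∃ f ∈ I, f ≠ 0 ∧ ord.degree f ≤ a := by
  have h : ini ord I = Ideal.span ((fun a => monomial a (1 : k)) ''
      (ord.degree '' ((I : Set (MvPolynomial σ k)) \ {0}))) := by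
    rw [ini, ← MonomialOrder.span_leadingTerm_sdiff_singleton_zero,
      MonomialOrder.span_leadingTerm_eq_span_monomial, Set.image_image]
    intro f hf
    exact (MonomialOrder.leadingCoeff_ne_zero_iff.mpr hf.2).isUnit
  rw [h, mem_ideal_span_monomial_image]
  simp [and_assoc]

/-- Leading exponents are closed under adding exponents (multiply by a monomial), so divisibility by
a leading monomial can be sharpened to equality. -/
theorem monomial_mem_ini_iff {ord : MonomialOrder σ} {I : Ideal (MvPolynomial σ k)}
    {a : σ →₀ ℕ} :
    monomial a (1 : k) ∈ ini ord I ↔ ∃ f ∈ I, f ≠ 0 ∧ ord.degree f = a := by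
  classical
  rw [mem_ini_iff]
  simp only [support_monomial, one_ne_zero, if_false, Finset.mem_singleton, forall_eq]
  constructor
  · rintro ⟨f, hf, hf0, hle⟩
    have hm : (monomial (a - ord.degree f) (1 : k)) ≠ 0 := by simp
    refine ⟨monomial (a - ord.degree f) 1 * f, I.mul_mem_left _ hf, mul_ne_zero hm hf0, ?_⟩
    rw [MonomialOrder.degree_mul hm hf0, MonomialOrder.degree_monomial]
    simp [tsub_add_cancel_of_le hle]
  · rintro ⟨f, hf, hf0, rfl⟩
    exact ⟨f, hf, hf0, le_rfl⟩

theorem isMonomialIdeal_ini (ord : MonomialOrder σ) (I : Ideal (MvPolynomial σ k)) :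
    IsMonomialIdeal (ini ord I) := by
  classical
  intro p hp a ha
  rw [mem_ini_iff] at hp ⊢
  intro c hc
  simp only [support_monomial, one_ne_zero, if_false, Finset.mem_singleton] at hc
  exact hc ▸ hp a ha

theorem ini_ne_top {ord : MonomialOrder σ} {I : Ideal (MvPolynomial σ k)} (hI : I ≠ ⊤) :
    ini ord I ≠ ⊤ := by
  intro h
  have h1 : monomial 0 (1 : k) ∈ ini ord I := h ▸ Submodule.mem_top
  obtain ⟨f, hf, hf0, hdeg⟩ := monomial_mem_ini_iff.mp h1
  refine hI (Ideal.eq_top_of_isUnit_mem _ hf ?_)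
  have hfC := MonomialOrder.eq_C_of_degree_eq_zero hdeg
  rw [hfC]
  exact ((MonomialOrder.leadingCoeff_ne_zero_iff.mpr hf0).isUnit).map C

theorem IsMonomialIdeal.constantCoeff_eq_zero {J : Ideal (MvPolynomial σ k)}
    (hJ : IsMonomialIdeal J) (hJt : J ≠ ⊤) {p : MvPolynomial σ k} (hp : p ∈ J) :
    constantCoeff p = 0 := by
  by_contra h
  exact hJt ((Ideal.eq_top_iff_one _).mpr (hJ p hp 0 (by simpa [constantCoeff_eq] using h)))

theorem IsMonomialIdeal.sup_span_singleton_ne_top {J : Ideal (MvPolynomial σ k)}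
    (hJ : IsMonomialIdeal J) (hJt : J ≠ ⊤) {f : MvPolynomial σ k} (hf : constantCoeff f = 0) :
    J ⊔ Ideal.span {f} ≠ ⊤ := by
  have hle : J ⊔ Ideal.span {f} ≤ RingHom.ker (constantCoeff : MvPolynomial σ k →+* k) := by
    refine sup_le (fun p hp => hJ.constantCoeff_eq_zero hJt hp) ?_
    rw [Ideal.span_le, Set.singleton_subset_iff]
    exact hf
  intro h
  have : (1 : MvPolynomial σ k) ∈ RingHom.ker (constantCoeff : MvPolynomial σ k →+* k) :=
    hle (h ▸ Submodule.mem_top)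
  simp at this

/-! ### Replacing exponents in a set of variables -/

/-- Replacing the part `α` of an exponent vector in the variables of `Y` by `β` does not lead out
of the set of exponents of the monomials of `J`. -/
def StableUnderReplace (Y : Finset σ) (α β : σ →₀ ℕ) (J : Ideal (MvPolynomial σ k)) : Prop :=
  ∀ u : σ →₀ ℕ, (∀ y ∈ Y, u y = 0) →
    monomial (u + α) (1 : k) ∈ J → monomial (u + β) (1 : k) ∈ J

open Classical in
/-- The linear operator `x^(u + α) ↦ x^(u + β)` for `u` vanishing on `Y`, which kills all the
monomials that are not of this form. -/
noncomputable def replaceMap (Y : Finset σ) (α β : σ →₀ ℕ) :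
    MvPolynomial σ k →ₗ[k] MvPolynomial σ k :=
  (basisMonomials σ k).constr k fun a =>
    if ∃ u : σ →₀ ℕ, (∀ y ∈ Y, u y = 0) ∧ a = u + α then monomial (a - α + β) 1 else 0

variable {Y : Finset σ} {α β : σ →₀ ℕ}

theorem replaceMap_monomial_add (c : k) {u : σ →₀ ℕ} (hu : ∀ y ∈ Y, u y = 0) :
    replaceMap Y α β (monomial (u + α) c) = monomial (u + β) c := by
  have h1 : monomial (u + α) c = c • basisMonomials σ k (u + α) := by
    simp [smul_monomial]
  rw [h1, map_smul, replaceMap, Module.Basis.constr_basis, if_pos ⟨u, hu, rfl⟩,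
    add_tsub_cancel_right, smul_monomial, smul_eq_mul, mul_one]

theorem replaceMap_monomial_eq_zero (c : k) {a : σ →₀ ℕ}
    (ha : ¬ ∃ u : σ →₀ ℕ, (∀ y ∈ Y, u y = 0) ∧ a = u + α) :
    replaceMap Y α β (monomial a c) = 0 := by
  have h1 : monomial a c = c • basisMonomials σ k a := by
    simp [smul_monomial]
  rw [h1, map_smul, replaceMap, Module.Basis.constr_basis, if_neg ha, smul_zero]

theorem exists_of_mem_support_replaceMap {p : MvPolynomial σ k} {w : σ →₀ ℕ}
    (hw : w ∈ (replaceMap Y α β p).support) :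
    ∃ u : σ →₀ ℕ, (∀ y ∈ Y, u y = 0) ∧ u + α ∈ p.support ∧ w = u + β := by
  classical
  rw [← support_sum_monomial_coeff p, map_sum] at hw
  obtain ⟨a, ha, hwa⟩ := Finset.mem_biUnion.mp (support_sum hw)
  by_cases h : ∃ u : σ →₀ ℕ, (∀ y ∈ Y, u y = 0) ∧ a = u + α
  · obtain ⟨u, hu, rfl⟩ := h
    rw [replaceMap_monomial_add _ hu] at hwa
    exact ⟨u, hu, ha, by simpa using support_monomial_subset hwa⟩
  · rw [replaceMap_monomial_eq_zero _ h] at hwa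
    simp at hwa

theorem coeff_replaceMap (p : MvPolynomial σ k) {u : σ →₀ ℕ} (hu : ∀ y ∈ Y, u y = 0) :
    coeff (u + β) (replaceMap Y α β p) = coeff (u + α) p := by
  classical
  induction p using MvPolynomial.induction_on' with
  | monomial a c =>
    by_cases h : ∃ u : σ →₀ ℕ, (∀ y ∈ Y, u y = 0) ∧ a = u + α
    · obtain ⟨v, hv, rfl⟩ := h
      rw [replaceMap_monomial_add _ hv, coeff_monomial, coeff_monomial]
      simp only [add_left_inj]
    · rw [replaceMap_monomial_eq_zero _ h, coeff_zero, coeff_monomial, if_neg]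
      rintro rfl
      exact h ⟨u, hu, rfl⟩
  | add p q hp hq => rw [map_add, coeff_add, coeff_add, hp, hq]

/-- Since `α` lives on `Y`, whether a monomial survives depends only on its exponents on `Y`, and
multiplying by a monomial of `F` does not change these. -/
theorem replaceMap_mul_of_support {F : MvPolynomial σ k}
    (hF : ∀ c ∈ F.support, ∀ y ∈ Y, c y = 0) (hα : ∀ y ∉ Y, α y = 0) (s : MvPolynomial σ k) :
    replaceMap Y α β (F * s) = F * replaceMap Y α β s := by
  classical
  induction s using MvPolynomial.induction_on' with
  | add p q hp hq => rw [mul_add, map_add, map_add, hp, hq, mul_add]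
  | monomial a r =>
    conv_lhs => rw [← support_sum_monomial_coeff F]
    conv_rhs => rw [← support_sum_monomial_coeff F]
    rw [Finset.sum_mul, Finset.sum_mul, map_sum]
    refine Finset.sum_congr rfl fun c hc => ?_
    rw [monomial_mul]
    by_cases h : ∃ u : σ →₀ ℕ, (∀ y ∈ Y, u y = 0) ∧ a = u + α
    · obtain ⟨u, hu, rfl⟩ := h
      have hcu : ∀ y ∈ Y, (c + u) y = 0 := fun y hy => by simp [hu y hy, hF c hc y hy]
      rw [← add_assoc, replaceMap_monomial_add _ hcu, replaceMap_monomial_add _ hu, monomial_mul,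
        add_assoc]
    · rw [replaceMap_monomial_eq_zero _ h, mul_zero, replaceMap_monomial_eq_zero]
      rintro ⟨u, hu, hcu⟩
      refine h ⟨a - α, fun y hy => ?_, ?_⟩
      · have := DFunLike.congr_fun hcu y
        simp only [Finsupp.add_apply, hF c hc y hy, hu y hy] at this
        simp only [Finsupp.tsub_apply]
        omega
      · refine (tsub_add_cancel_of_le fun y => ?_).symm
        by_cases hy : y ∈ Y
        · have := DFunLike.congr_fun hcu y
          simp only [Finsupp.add_apply, hF c hc y hy, hu y hy] at this
          omega
        · simp [hα y hy]

theorem StableUnderReplace.replaceMap_mem {J : Ideal (MvPolynomial σ k)}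
    (hJ : IsMonomialIdeal J) (h : StableUnderReplace Y α β J) {p : MvPolynomial σ k}
    (hp : p ∈ J) : replaceMap Y α β p ∈ J := by
  refine mem_of_monomials_mem fun w hw => ?_
  obtain ⟨u, hu, hup, rfl⟩ := exists_of_mem_support_replaceMap hw
  exact h u hu (hJ p hp _ hup)

/-- If f has leading exponent `u + α`, its image under `replaceMap` stays in `J + (F)` and has
leading exponent `u + β`: the surviving exponents `v + α` become `v + β`, and translation preserves
their order. -/
theorem StableUnderReplace.ini_sup_span {J : Ideal (MvPolynomial σ k)} (hJ : IsMonomialIdeal J)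
    (h : StableUnderReplace Y α β J) (hα : ∀ y ∉ Y, α y = 0) {F : MvPolynomial σ k}
    (hF : ∀ c ∈ F.support, ∀ y ∈ Y, c y = 0) (ord : MonomialOrder σ) :
    StableUnderReplace Y α β (ini ord (J ⊔ Ideal.span {F})) := by
  intro u hu hmem
  obtain ⟨f, hf, hf0, hdeg⟩ := monomial_mem_ini_iff.mp hmem
  have hc : coeff (u + β) (replaceMap Y α β f) ≠ 0 := by
    rw [coeff_replaceMap f hu, ← hdeg]
    exact MonomialOrder.coeff_degree_ne_zero_iff.mpr hf0
  refine monomial_mem_ini_iff.mpr ⟨replaceMap Y α β f, ?_, ?_, ?_⟩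
  · obtain ⟨p, hp, r, hr, rfl⟩ := Submodule.mem_sup.mp hf
    obtain ⟨s, rfl⟩ := Ideal.mem_span_singleton'.mp hr
    rw [map_add, mul_comm s F, replaceMap_mul_of_support hF hα]
    exact Submodule.add_mem_sup (h.replaceMap_mem hJ hp)
      (Ideal.mul_mem_right _ _ (Ideal.mem_span_singleton_self F))
  · rintro h0
    simp [h0] at hc
  · apply ord.toSyn.injective
    refine le_antisymm (MonomialOrder.degree_le_iff.mpr fun w hw => ?_)
      (MonomialOrder.le_degree (mem_support_iff.mpr hc))
    obtain ⟨v, -, hvf, rfl⟩ := exists_of_mem_support_replaceMap hw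
    have := MonomialOrder.le_degree (m := ord) hvf
    rw [hdeg, map_add, map_add, add_le_add_iff_right] at this
    rw [map_add, map_add, add_le_add_iff_right]
    exact this

/-! ### Adapted groups of variables and regularity -/

/-- The set of exponent vectors of the monomials of `J`. -/
def exponents (J : Ideal (MvPolynomial σ k)) : Set (σ →₀ ℕ) :=
  {a | monomial a (1 : k) ∈ J}

/-- The exponent set of a monomial ideal whose minimal generators have degree at most one in the
variables of `S`, and contain a variable of `S` if they contain `x`. -/
structure Adapted (x : σ) (S : Finset σ) (L : Set (σ →₀ ℕ)) : Prop where
  of_add_single_of_ne_zero : ∀ y ∈ S, ∀ a : σ →₀ ℕ, a y ≠ 0 → a + Finsupp.single y 1 ∈ L → a ∈ L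
  of_add_single : ∀ a : σ →₀ ℕ, (∀ y ∈ S, a y = 0) → a + Finsupp.single x 1 ∈ L → a ∈ L

/-- The variables of `S₀` are eliminated from g one by one. Once none is left, the product is x * g,
and the condition on x forces the monomials of g into `J`. -/
theorem eq_zero_of_sum_X_mul_mem {J : Ideal (MvPolynomial σ k)} (hJ : IsMonomialIdeal J)
    {x : σ} {S₀ : Finset σ} (hx : x ∉ S₀)
    (h : Adapted x S₀ (exponents J))
    {S : Finset σ} (hS : S ⊆ S₀) {g : MvPolynomial σ k}
    (hg : ∀ a ∈ g.support, monomial a (1 : k) ∉ J)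
    (hg' : ∀ a ∈ g.support, ∀ y ∈ S₀, y ∉ S → a y = 0)
    (hmem : (X x + ∑ y ∈ S, X y) * g ∈ J) : g = 0 := by
  classical
  induction S using Finset.induction_on with
  | empty =>
    by_contra hg0
    obtain ⟨a, ha⟩ := support_nonempty.mpr hg0
    refine hg a ha (h.of_add_single a (fun y hy => hg' a ha y hy (by simp)) (hJ _ hmem _ ?_))
    rw [Finset.sum_empty, add_zero, mem_support_iff, add_comm, coeff_X_mul]
    exact mem_support_iff.mp ha
  | insert y S hyS ih =>
    have hy₀ : y ∈ S₀ := hS (Finset.mem_insert_self _ _)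
    have hxy : x ≠ y := fun h => hx (h ▸ hy₀)
    set F : MvPolynomial σ k := X x + ∑ z ∈ S, X z with hFdef
    have hsplit : (X x + ∑ z ∈ insert y S, X z) * g = X y * g + F * g := by
      rw [Finset.sum_insert hyS, hFdef]; ring
    rw [hsplit] at hmem
    have hF : ∀ c ∈ F.support, c y = 0 := by
      intro c hc
      rcases Finset.mem_union.mp (support_add hc) with h | h
      · rw [support_X, Finset.mem_singleton] at h
        simp [h, hxy]
      · obtain ⟨z, hz, hcz⟩ := Finset.mem_biUnion.mp (support_sum h)
        rw [support_X, Finset.mem_singleton] at hcz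
        have : z ≠ y := fun h => hyS (h ▸ hz)
        simp [hcz, this]
    by_cases hd : ∀ a ∈ g.support, a y = 0
    · refine ih ((Finset.subset_insert _ _).trans hS) (fun a ha z hz hzS => ?_) ?_
      · by_cases hzy : z = y
        · exact hzy ▸ hd a ha
        · exact hg' a ha z hz (by simp [hzy, hzS])
      -- With g free of y, the monomials of `F * g` are free of y and those of `X y * g` are not, so
      -- the two summands cannot cancel and `F * g` is in `J`.
      · refine mem_of_monomials_mem fun c hc => hJ _ hmem c ?_
        have hcy : c y = 0 := by
          obtain ⟨c₁, hc₁, c₂, hc₂, rfl⟩ := Finset.mem_add.mp (support_mul _ _ hc)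
          simp [hF c₁ hc₁, hd c₂ hc₂]
        rw [mem_support_iff, coeff_add, coeff_X_mul', if_neg (by simpa using hcy), zero_add]
        exact mem_support_iff.mp hc
    · exfalso
      push Not at hd
      obtain ⟨a₀, ha₀, ha₀y⟩ := hd
      -- For a of maximal degree in y, the monomial a + e_y is out of reach of `F * g`. It therefore
      -- occurs in the product and lies in `J`, and degree at most one in y gives a ∈ `J`.
      obtain ⟨a, ha, hmax⟩ := g.support.exists_max_image (fun a => a y) ⟨a₀, ha₀⟩
      have hay : a y ≠ 0 := by have := hmax a₀ ha₀; omega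
      refine hg a ha (h.of_add_single_of_ne_zero y hy₀ a hay (hJ _ hmem _ ?_))
      have hzero : coeff (Finsupp.single y 1 + a) (F * g) = 0 := by
        by_contra hne
        obtain ⟨c₁, hc₁, c₂, hc₂, heq⟩ :=
          Finset.mem_add.mp (support_mul _ _ (mem_support_iff.mpr hne))
        have h := DFunLike.congr_fun heq y
        have := hmax c₂ hc₂
        simp only [Finsupp.add_apply, hF c₁ hc₁, Finsupp.single_eq_same] at h
        omega
      rw [mem_support_iff, add_comm a, coeff_add, coeff_X_mul, hzero, add_zero]
      exact mem_support_iff.mp ha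

theorem mem_of_sum_X_mul_mem {J : Ideal (MvPolynomial σ k)} (hJ : IsMonomialIdeal J)
    {x : σ} {S : Finset σ} (hx : x ∉ S)
    (h : Adapted x S (exponents J))
    {g : MvPolynomial σ k} (hmem : (X x + ∑ y ∈ S, X y) * g ∈ J) : g ∈ J := by
  classical
  set g₁ : MvPolynomial σ k :=
    ∑ a ∈ g.support.filter (fun a => monomial a (1 : k) ∉ J), monomial a (coeff a g) with hg₁
  set g₂ : MvPolynomial σ k :=
    ∑ a ∈ g.support.filter (fun a => ¬ monomial a (1 : k) ∉ J), monomial a (coeff a g) with hg₂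
  have hadd : g₁ + g₂ = g := by
    rw [hg₁, hg₂, Finset.sum_filter_add_sum_filter_not, support_sum_monomial_coeff]
  have hg₂J : g₂ ∈ J := by
    refine J.sum_mem fun a ha => ?_
    rw [← mul_one (coeff a g), ← C_mul_monomial]
    exact J.mul_mem_left _ (not_not.mp (Finset.mem_filter.mp ha).2)
  have hsupp : ∀ a ∈ g₁.support, monomial a (1 : k) ∉ J := by
    intro a ha
    obtain ⟨c, hc, hac⟩ := Finset.mem_biUnion.mp (support_sum ha)
    have := support_monomial_subset hac
    rw [Finset.mem_singleton] at this
    exact this ▸ (Finset.mem_filter.mp hc).2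
  have h0 : g₁ = 0 := by
    refine eq_zero_of_sum_X_mul_mem hJ hx h subset_rfl hsupp
      (fun a _ y hy hy' => absurd hy hy') ?_
    have : (X x + ∑ y ∈ S, X y) * g₁ =
        (X x + ∑ y ∈ S, X y) * g - (X x + ∑ y ∈ S, X y) * g₂ := by
      rw [← hadd]; ring
    rw [this]
    exact J.sub_mem hmem (J.mul_mem_left _ hg₂J)
  rw [← hadd, h0, zero_add]
  exact hg₂J

/-- Each condition is a family of replacements, one for every fixed exponent: y^(m+1) by y^m with m
≥ 1 and `Y = {y}`, or x^(m+1) by x^m on monomials free of `S`, with `Y = insert x S`. -/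
theorem Adapted.ini_sup_span {J : Ideal (MvPolynomial σ k)} (hJ : IsMonomialIdeal J)
    {x : σ} {S : Finset σ} (hx : x ∉ S) (h : Adapted x S (exponents J)) {F : MvPolynomial σ k}
    (hF : ∀ c ∈ F.support, c x = 0 ∧ ∀ y ∈ S, c y = 0) (ord : MonomialOrder σ) :
    Adapted x S (exponents (ini ord (J ⊔ Ideal.span {F}))) := by
  classical
  have key : ∀ (y : σ) (a : σ →₀ ℕ), a = a.erase y + Finsupp.single y (a y) ∧
      a + Finsupp.single y 1 = a.erase y + Finsupp.single y (a y + 1) := by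
    intro y a
    refine ⟨(Finsupp.erase_add_single y a).symm, ?_⟩
    rw [Finsupp.single_add, ← add_assoc, Finsupp.erase_add_single]
  constructor
  · intro y hy a hay ha
    have hst : StableUnderReplace {y} (Finsupp.single y (a y + 1)) (Finsupp.single y (a y)) J := by
      intro u hu hmem
      replace hu := hu y (Finset.mem_singleton_self y)
      rw [Finsupp.single_add, ← add_assoc] at hmem
      exact h.of_add_single_of_ne_zero y hy _ (by simpa [hu] using hay) hmem
    have := hst.ini_sup_span hJ (fun z hz => by
      simp only [Finset.mem_singleton] at hz
      simp [Ne.symm hz]) (F := F)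
      (fun c hc z hz => by rw [Finset.mem_singleton] at hz; exact hz ▸ (hF c hc).2 y hy) ord
      (a.erase y) (by simp)
    rw [← (key y a).1, ← (key y a).2] at this
    exact this ha
  · intro a haS ha
    have hst : StableUnderReplace (insert x S) (Finsupp.single x (a x + 1))
        (Finsupp.single x (a x)) J := by
      intro u hu hmem
      rw [Finsupp.single_add, ← add_assoc] at hmem
      refine h.of_add_single _ (fun y hy => ?_) hmem
      have hxy : x ≠ y := fun e => hx (e ▸ hy)
      simp [hu y (Finset.mem_insert_of_mem hy), hxy]
    have := hst.ini_sup_span hJ (fun z hz => by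
      have : x ≠ z := fun e => hz (e ▸ Finset.mem_insert_self _ _)
      simp [this]) (F := F)
      (fun c hc z hz => by
        rcases Finset.mem_insert.mp hz with rfl | hz
        · exact (hF c hc).1
        · exact (hF c hc).2 z hz) ord
      (a.erase x) (fun z hz => by
        rcases Finset.mem_insert.mp hz with rfl | hz
        · simp
        · have hxz : z ≠ x := fun e => hx (e ▸ hz)
          simp [Finsupp.erase_ne hxz, haS z hz])
    rw [← (key x a).1, ← (key x a).2] at this
    exact this ha

theorem exists_minGens_le {J : Ideal (MvPolynomial σ k)} {a : σ →₀ ℕ}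
    (ha : monomial a (1 : k) ∈ J) : ∃ m ∈ minGens J, m ≤ a := by
  obtain ⟨m, hma, hm⟩ := exists_minimal_le_of_wellFoundedLT
    (fun c : σ →₀ ℕ => monomial c (1 : k) ∈ J) a ha
  exact ⟨m, hm, hma⟩

/-- A minimal generator dividing the larger monomial already divides the smaller one: its exponent
in y is at most 1 ≤ a y, respectively it avoids `S` and hence x. -/
theorem adapted_of_minGens {J : Ideal (MvPolynomial σ k)} {x : σ} {S : Finset σ} (hx : x ∉ S)
    (h₁ : ∀ y ∈ S, varDegree y J ≤ 1)
    (h₂ : ∀ a ∈ minGens J, a x ≠ 0 → ∃ y ∈ S, a y ≠ 0) : Adapted x S (exponents J) := by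
  constructor
  · intro y hy a hay ha
    obtain ⟨m, hm, hle⟩ := exists_minGens_le ha
    have hmy : m y ≤ 1 := by
      have := (le_iSup₂ (f := fun (a : σ →₀ ℕ) (_ : a ∈ minGens J) => (a y : ℕ∞)) m hm).trans
        (h₁ y hy)
      exact_mod_cast this
    refine monomial_mem_of_le (fun z => ?_) hm.1
    by_cases hz : y = z
    · subst hz; omega
    · have := hle z
      simpa [hz] using this
  · intro a haS ha
    obtain ⟨m, hm, hle⟩ := exists_minGens_le ha
    have hmS : ∀ y ∈ S, m y = 0 := by
      intro y hy
      have hxy : x ≠ y := fun e => hx (e ▸ hy)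
      have := hle y
      simpa [haS y hy, hxy] using this
    have hmx : m x = 0 := by
      by_contra hne
      obtain ⟨y, hy, hmy⟩ := h₂ m hm hne
      exact hmy (hmS y hy)
    refine monomial_mem_of_le (fun z => ?_) hm.1
    by_cases hz : x = z
    · subst hz; omega
    · have := hle z
      simpa [hz] using this

end MonomialIdeals

/-! ### The chain of initial ideals -/

section Chain

open MvPolynomial

variable {σ k : Type*} [Field k] {q : ℕ} {x : Fin q → σ} {S : Fin q → Finset σ}

theorem mem_support_X_add_sum {x : σ} {S : Finset σ} {c : σ →₀ ℕ}
    (hc : c ∈ (X x + ∑ y ∈ S, X y : MvPolynomial σ k).support) :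
    ∃ y, (y = x ∨ y ∈ S) ∧ c = Finsupp.single y 1 := by
  classical
  rcases Finset.mem_union.mp (support_add hc) with h | h
  · rw [support_X, Finset.mem_singleton] at h
    exact ⟨x, .inl rfl, h⟩
  · obtain ⟨z, hz, hcz⟩ := Finset.mem_biUnion.mp (support_sum h)
    rw [support_X, Finset.mem_singleton] at hcz
    exact ⟨z, .inr hz, hcz⟩

theorem constantCoeff_X_add_sum (x : σ) (S : Finset σ) :
    constantCoeff (X x + ∑ y ∈ S, X y : MvPolynomial σ k) = 0 := by
  simp [map_sum]

/-- The ideals of the chain are proper monomial ideals, and the groups of variables that have not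
been used yet are adapted to them. -/
theorem iniChain_adapted (hxx : Function.Injective x)
    (hxS : ∀ i j, x i ∉ S j) (hSS : ∀ i j, i ≠ j → Disjoint (S i) (S j))
    {I : Ideal (MvPolynomial σ k)} (hI : I ≠ ⊤) (ord : Fin q → MonomialOrder σ)
    (h : ∀ hq : 0 < q, ∀ i, Adapted (x i) (S i) (exponents (ini (ord ⟨0, hq⟩) I)))
    (m : ℕ) (hm : m < q) :
    IsMonomialIdeal (iniChain ord (fun i => X (x i) + ∑ y ∈ S i, X y) I m hm) ∧
      iniChain ord (fun i => X (x i) + ∑ y ∈ S i, X y) I m hm ≠ ⊤ ∧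
      ∀ i : Fin q, m ≤ i → Adapted (x i) (S i)
        (exponents (iniChain ord (fun i => X (x i) + ∑ y ∈ S i, X y) I m hm)) := by
  induction m with
  | zero =>
    exact ⟨isMonomialIdeal_ini _ _, ini_ne_top hI, fun i _ => h hm i⟩
  | succ m ih =>
    obtain ⟨hmon, htop, had⟩ := ih (Nat.lt_of_succ_lt hm)
    refine ⟨isMonomialIdeal_ini _ _,
      ini_ne_top (hmon.sup_span_singleton_ne_top htop (constantCoeff_X_add_sum _ _)),
      fun i hi => (had i (by omega)).ini_sup_span hmon (hxS i i) (fun c hc => ?_) _⟩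
    obtain ⟨z, hz, rfl⟩ := mem_support_X_add_sum hc
    have hne : i ≠ ⟨m, Nat.lt_of_succ_lt hm⟩ := by
      rintro rfl
      simp at hi
    rcases hz with rfl | hz
    · refine ⟨?_, fun y hy => ?_⟩
      · have : x i ≠ x ⟨m, Nat.lt_of_succ_lt hm⟩ := fun e => hne (hxx e)
        simp [this]
      · have : y ≠ x ⟨m, Nat.lt_of_succ_lt hm⟩ := fun e => hxS _ _ (e ▸ hy)
        simp [this]
    · refine ⟨?_, fun y hy => ?_⟩
      · have : x i ≠ z := fun e => hxS _ _ (e ▸ hz)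
        simp [this]
      · have : y ≠ z := fun e => Finset.disjoint_left.mp (hSS _ _ hne) hy (e ▸ hz)
        simp [this]

theorem isInitiallyRegular_of_adapted (hxx : Function.Injective x)
    (hxS : ∀ i j, x i ∉ S j) (hSS : ∀ i j, i ≠ j → Disjoint (S i) (S j))
    {I : Ideal (MvPolynomial σ k)} (hI : I ≠ ⊤) (ord : Fin q → MonomialOrder σ)
    (h : ∀ hq : 0 < q, ∀ i, Adapted (x i) (S i) (exponents (ini (ord ⟨0, hq⟩) I))) :
    IsInitiallyRegular ord (fun i => X (x i) + ∑ y ∈ S i, X y) I := by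
  classical
  refine ⟨hI, fun i => ?_⟩
  obtain ⟨hmon, htop, had⟩ := iniChain_adapted hxx hxS hSS hI ord h i i.isLt
  refine ⟨?_, ?_, hmon.sup_span_singleton_ne_top htop (constantCoeff_X_add_sum _ _)⟩
  · rintro ⟨c, hc⟩
    have h1 := congrArg (coeff (Finsupp.single (x i) 1)) hc
    have h2 : ∀ y ∈ S i, coeff (Finsupp.single (x i) 1) (X y : MvPolynomial σ k) = 0 := by
      intro y hy
      have : y ≠ x i := fun e => hxS i i (e ▸ hy)
      rw [coeff_X, if_neg]
      exact fun e => this (Finsupp.single_left_injective one_ne_zero e)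
    rw [coeff_add, coeff_sum, Finset.sum_eq_zero h2, coeff_X, add_zero, coeff_C, if_neg] at h1
    · simp at h1
    · exact fun e => by simpa using DFunLike.congr_fun e (x i)
  · refine (isSMulRegular_quotient_iff_mem_of_smul_mem _ _).mpr fun g hg => ?_
    exact mem_of_sum_X_mul_mem hmon (hxS i i) (had i le_rfl) hg

end Chain

end InitReg

namespace InitReg

/-! ### Monomial ideals with linear quotients -/

section LinearQuotients

variable {σ : Type*}

/-- `L` is the exponent set of a monomial ideal with monomial generators, in the variables of `A`,
that can be ordered in such a way that the ideal of the previous generators, divided by any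
generator, is generated by fewer than `s` variables. -/
inductive HasLinearQuotients (A : Finset σ) (s : ℕ) : Set (σ →₀ ℕ) → Prop
  | empty : HasLinearQuotients A s ∅
  | add {L : Set (σ →₀ ℕ)} {a : σ →₀ ℕ} {Z : Finset σ} (hL : HasLinearQuotients A s L)
      (ha : a.support ⊆ A) (hZ : Z.card < s) (h : ∀ u, a + u ∈ L ↔ ∃ z ∈ Z, u z ≠ 0) :
      HasLinearQuotients A s (L ∪ Set.Ici a)

namespace HasLinearQuotients

theorem mono {A A' : Finset σ} {s s' : ℕ} {L : Set (σ →₀ ℕ)} (h : HasLinearQuotients A s L)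
    (hA : A ⊆ A') (hs : s ≤ s') : HasLinearQuotients A' s' L := by
  induction h with
  | empty => exact .empty
  | add _ ha hZ h ih => exact .add ih (ha.trans hA) (hZ.trans_le hs) h

theorem of_zero_mem {A : Finset σ} {s : ℕ} (hs : 0 < s) {L : Set (σ →₀ ℕ)} (hL : IsUpperSet L)
    (h0 : (0 : σ →₀ ℕ) ∈ L) : HasLinearQuotients A s L := by
  have : L = ∅ ∪ Set.Ici 0 := by
    ext a
    simp [hL (zero_le : 0 ≤ a) h0]
  rw [this]
  exact .add (Z := ∅) .empty (by simp) (by simpa using hs) (by simp)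

theorem image_single_add {A : Finset σ} {s : ℕ} {L : Set (σ →₀ ℕ)}
    (h : HasLinearQuotients A s L) {x : σ} (hx : x ∈ A) :
    HasLinearQuotients A s ((Finsupp.single x 1 + ·) '' L) := by
  classical
  induction h with
  | empty => simpa using HasLinearQuotients.empty
  | @add L a Z _ ha hZ h ih =>
    have himage : (Finsupp.single x 1 + ·) '' Set.Ici a = Set.Ici (Finsupp.single x 1 + a) := by
      ext c
      constructor
      · rintro ⟨d, hd, rfl⟩
        exact add_le_add_right (Set.mem_Ici.mp hd) _
      · intro hc
        refine ⟨c - Finsupp.single x 1, ?_, ?_⟩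
        · rw [Set.mem_Ici, ← add_tsub_cancel_left (Finsupp.single x 1) a]
          exact tsub_le_tsub_right hc _
        · exact add_tsub_cancel_of_le (le_self_add.trans hc)
    rw [Set.image_union, himage]
    refine .add ih ?_ hZ fun u => ?_
    · refine Finsupp.support_add.trans (Finset.union_subset ?_ ha)
      exact Finsupp.support_single_subset.trans (Finset.singleton_subset_iff.mpr hx)
    · rw [add_assoc, ← h u]
      exact (add_right_injective (Finsupp.single x 1)).mem_set_image

/-- As an ideal, L is the sum of x·(L : x) and the extension of its part free of x. List the
generators of x·(L : x) first. A generator a of the second part then gets x as one new colon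
variable, because xa lies in x·(L : x); this accounts for `t + 1`. -/
theorem of_colon_of_erase {A : Finset σ} [DecidableEq σ] {s t : ℕ} {L : Set (σ →₀ ℕ)}
    (hL : IsUpperSet L) {x : σ} (hx : x ∈ A)
    (h₁ : HasLinearQuotients A s {a | a + Finsupp.single x 1 ∈ L})
    (h₀ : HasLinearQuotients (A.erase x) t {a | a.erase x ∈ L}) (hts : t + 1 ≤ s) :
    HasLinearQuotients A s L := by
  set L₁ := {a | a + Finsupp.single x 1 ∈ L} with hL₁
  have herase : ∀ a : σ →₀ ℕ, a.erase x ∈ L → a ∈ L := fun a ha => by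
    refine hL ?_ ha
    conv_rhs => rw [← Finsupp.erase_add_single x a]
    exact le_self_add
  have key : ∀ M, HasLinearQuotients (A.erase x) t M → M ⊆ {a | a.erase x ∈ L} →
      HasLinearQuotients A s ((Finsupp.single x 1 + ·) '' L₁ ∪ M) := by
    intro M hM
    induction hM with
    | empty =>
      intro _
      rw [Set.union_empty]
      exact h₁.image_single_add hx
    | @add M a Z _ ha hZ h ih =>
      intro hML
      rw [Set.union_subset_iff] at hML
      rw [← Set.union_assoc]
      refine .add (Z := insert x Z) (ih hML.1) (ha.trans (Finset.erase_subset _ _))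
        ((Finset.card_insert_le _ _).trans_lt (by omega)) fun u => ?_
      have hax : a x = 0 := by
        by_contra hne
        have := ha (Finsupp.mem_support_iff.mpr hne)
        simp at this
      rw [Set.mem_union, h u, Finset.exists_mem_insert]
      -- As a is free of x, a + u can be divisible by x only if u is.
      refine or_congr_left ⟨?_, fun hu => ?_⟩
      · rintro ⟨c, -, hc⟩
        have := DFunLike.congr_fun hc x
        simp only [Finsupp.add_apply, Finsupp.single_eq_same, hax] at this
        omega
      · have hsu : Finsupp.single x 1 + (u - Finsupp.single x 1) = u := by
          refine add_tsub_cancel_of_le ?_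
          rw [Finsupp.single_le_iff]
          omega
        refine ⟨a + (u - Finsupp.single x 1), ?_, ?_⟩
        · rw [hL₁, Set.mem_ofPred_eq, add_assoc, add_comm _ (Finsupp.single x 1), hsu]
          exact hL le_self_add (herase a (hML.2 Set.self_mem_Ici))
        · simp only []
          rw [add_left_comm, hsu]
  have : L = (Finsupp.single x 1 + ·) '' L₁ ∪ {a | a.erase x ∈ L} := by
    ext c
    constructor
    · intro hc
      by_cases hcx : c x = 0
      · right
        have : c.erase x = c := Finsupp.erase_of_notMem_support (by simpa using hcx)
        rw [Set.mem_ofPred_eq, this]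
        exact hc
      · left
        have hle : Finsupp.single x 1 ≤ c := by
          rw [Finsupp.single_le_iff]
          omega
        refine ⟨c - Finsupp.single x 1, ?_, add_tsub_cancel_of_le hle⟩
        rw [hL₁, Set.mem_ofPred_eq, tsub_add_cancel_of_le hle]
        exact hc
    · rintro (⟨c, hc, rfl⟩ | hc)
      · simp only []
        rw [add_comm]
        exact hc
      · exact herase c hc
  rw [this]
  exact key _ h₀ subset_rfl

end HasLinearQuotients

/-- The minimal elements of `L` have exponent at most `N` in the variable `y`. -/
def BoundedAt (y : σ) (N : ℕ) (L : Set (σ →₀ ℕ)) : Prop :=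
  ∀ a : σ →₀ ℕ, N ≤ a y → a + Finsupp.single y 1 ∈ L → a ∈ L

theorem BoundedAt.erase_mem {y : σ} {L : Set (σ →₀ ℕ)} (h : BoundedAt y 0 L) {a : σ →₀ ℕ}
    (ha : a ∈ L) : a.erase y ∈ L := by
  have key : ∀ m : ℕ, ∀ c : σ →₀ ℕ, c + Finsupp.single y m ∈ L → c ∈ L := by
    intro m
    induction m with
    | zero => intro c hc; simpa using hc
    | succ m ih =>
      intro c hc
      rw [Finsupp.single_add, ← add_assoc] at hc
      exact ih c (h _ (Nat.zero_le _) hc)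
  exact key (a y) _ (by rwa [Finsupp.erase_add_single])

theorem zero_mem_of_boundedAt_zero {L : Set (σ →₀ ℕ)} (h : ∀ y, BoundedAt y 0 L) {a : σ →₀ ℕ}
    (ha : a ∈ L) : (0 : σ →₀ ℕ) ∈ L := by
  classical
  induction a using Finsupp.induction with
  | zero => exact ha
  | single_add y m f hy _ ih =>
    refine ih ?_
    have := (h y).erase_mem ha
    rwa [Finsupp.erase_add, Finsupp.erase_single, zero_add,
      Finsupp.erase_of_notMem_support hy] at this

theorem BoundedAt.colon {y x : σ} {N : ℕ} {L : Set (σ →₀ ℕ)} (h : BoundedAt y N L) :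
    BoundedAt y N {a | a + Finsupp.single x 1 ∈ L} := by
  intro a ha hmem
  rw [Set.mem_ofPred_eq, add_right_comm] at hmem
  exact h _ (by simp only [Finsupp.add_apply]; omega) hmem

theorem BoundedAt.colon_self {x : σ} {N : ℕ} {L : Set (σ →₀ ℕ)} (h : BoundedAt x (N + 1) L) :
    BoundedAt x N {a | a + Finsupp.single x 1 ∈ L} := fun a ha hmem =>
  h _ (by simp only [Finsupp.add_apply, Finsupp.single_eq_same]; omega) hmem

theorem BoundedAt.erase {y x : σ} {N : ℕ} {L : Set (σ →₀ ℕ)} (h : BoundedAt y N L) :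
    BoundedAt y N {a | a.erase x ∈ L} := by
  intro a ha hmem
  rw [Set.mem_ofPred_eq, Finsupp.erase_add] at hmem
  by_cases hxy : y = x
  · subst hxy
    rw [Finsupp.erase_single, add_zero] at hmem
    exact hmem
  · rw [Finsupp.erase_single_ne (Ne.symm hxy)] at hmem
    exact h _ (by rwa [Finsupp.erase_ne hxy]) hmem

theorem boundedAt_erase_self {x : σ} {N : ℕ} {L : Set (σ →₀ ℕ)} :
    BoundedAt x N {a | a.erase x ∈ L} := by
  intro a _ hmem
  rwa [Set.mem_ofPred_eq, Finsupp.erase_add, Finsupp.erase_single, add_zero] at hmem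

theorem Adapted.colon {x : σ} {S : Finset σ} {L : Set (σ →₀ ℕ)} (h : Adapted x S L) {z : σ}
    (hz : z ∉ S) : Adapted x S {a | a + Finsupp.single z 1 ∈ L} := by
  constructor
  · intro y hy a hay ha
    rw [Set.mem_ofPred_eq, add_right_comm] at ha
    exact h.of_add_single_of_ne_zero y hy _ (by simp only [Finsupp.add_apply]; omega) ha
  · intro a haS ha
    rw [Set.mem_ofPred_eq, add_right_comm] at ha
    refine h.of_add_single _ (fun y hy => ?_) ha
    have : y ≠ z := fun e => hz (e ▸ hy)
    simp [haS y hy, this]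

theorem Adapted.erase [DecidableEq σ] {x : σ} {S : Finset σ} {L : Set (σ →₀ ℕ)}
    (h : Adapted x S L) {z : σ} (hz : z ≠ x) : Adapted x (S.erase z) {a | a.erase z ∈ L} := by
  constructor
  · intro y hy a hay ha
    have hyz := Finset.ne_of_mem_erase hy
    rw [Set.mem_ofPred_eq, Finsupp.erase_add, Finsupp.erase_single_ne hyz.symm] at ha
    exact h.of_add_single_of_ne_zero y (Finset.mem_of_mem_erase hy) _
      (by rwa [Finsupp.erase_ne hyz]) ha
  · intro a haS ha
    rw [Set.mem_ofPred_eq, Finsupp.erase_add, Finsupp.erase_single_ne hz] at ha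
    refine h.of_add_single _ (fun y hy => ?_) ha
    by_cases hyz : y = z
    · subst hyz; simp
    · rw [Finsupp.erase_ne hyz]
      exact haS y (Finset.mem_erase.mpr ⟨hyz, hy⟩)

theorem isUpperSet_colon {L : Set (σ →₀ ℕ)} (hL : IsUpperSet L) (x : σ) :
    IsUpperSet {a | a + Finsupp.single x 1 ∈ L} := fun _ _ hab ha =>
  hL (add_le_add_left hab _) ha

theorem isUpperSet_erase {L : Set (σ →₀ ℕ)} (hL : IsUpperSet L) (x : σ) :
    IsUpperSet {a : σ →₀ ℕ | a.erase x ∈ L} := fun a c hac ha =>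
  hL (fun y => by
    by_cases hy : y = x
    · subst hy; simp
    · rw [Finsupp.erase_ne hy, Finsupp.erase_ne hy]; exact hac y) ha

/-- The invariant is that `A` contains all variables that occur and `A.card = s + G.card`. Splitting
at a variable z of some `T i` shrinks `A` in both branches: the colon by z discards the whole group,
keeping s, and setting z = 0 keeps the group and lowers s by one. -/
theorem hasLinearQuotients_of_adapted {ι : Type*} {x : ι → σ} {N : ℕ} (A : Finset σ)
    {G : Finset ι} {T : ι → Finset σ} {s : ℕ} {L : Set (σ →₀ ℕ)} (hL : IsUpperSet L)
    (h0 : (0 : σ →₀ ℕ) ∉ L) (hN : ∀ y, BoundedAt y N L) (hA : ∀ y ∉ A, BoundedAt y 0 L)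
    (hcard : A.card = s + G.card) (hxA : ∀ i ∈ G, x i ∈ A) (hTA : ∀ i ∈ G, T i ⊆ A)
    (hxx : Set.InjOn x G) (hxT : ∀ i ∈ G, ∀ j ∈ G, x i ∉ T j)
    (hTT : ∀ i ∈ G, ∀ j ∈ G, i ≠ j → Disjoint (T i) (T j))
    (had : ∀ i ∈ G, Adapted (x i) (T i) L) : HasLinearQuotients A s L := by
  classical
  induction A using Finset.strongInduction generalizing G T s L with
  | H A ih =>
  rcases G.eq_empty_or_nonempty with rfl | ⟨i, hi⟩
  · rcases A.eq_empty_or_nonempty with rfl | ⟨z, hz⟩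
    · have : L = ∅ := Set.eq_empty_of_forall_notMem fun a ha =>
        h0 (zero_mem_of_boundedAt_zero (fun y => hA y (by simp)) ha)
      rw [this]
      exact .empty
    · have hs : 0 < s := by
        have := Finset.card_pos.mpr ⟨z, hz⟩
        simp only [Finset.card_empty] at hcard
        omega
      have hcard' : (A.erase z).card = (s - 1) + (∅ : Finset ι).card := by
        rw [Finset.card_erase_of_mem hz, hcard]
        simp
      have step : ∀ M : Set (σ →₀ ℕ), IsUpperSet M → (0 : σ →₀ ℕ) ∉ M → (∀ y, BoundedAt y N M) →
          (∀ y ∉ A.erase z, BoundedAt y 0 M) → HasLinearQuotients (A.erase z) (s - 1) M :=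
        fun M hM hM0 hMN hMA => ih _ (Finset.erase_ssubset hz) (G := ∅) (T := T) hM hM0 hMN hMA
          hcard' (by simp) (by simp) (by simp) (by simp) (by simp) (by simp)
      -- With no groups left, the colon by z may still involve z; the recursion ends because its
      -- degree bound in z drops.
      have key : ∀ (m : ℕ) (M : Set (σ →₀ ℕ)), IsUpperSet M → (0 : σ →₀ ℕ) ∉ M →
          (∀ y, BoundedAt y N M) → (∀ y ∉ A, BoundedAt y 0 M) → BoundedAt z m M →
          HasLinearQuotients A s M := by
        intro m
        induction m with
        | zero =>
          intro M hM hM0 hMN hMA hzM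
          refine (step M hM hM0 hMN fun y hy => ?_).mono (Finset.erase_subset _ _) (by omega)
          by_cases hyz : y = z
          · exact hyz ▸ hzM
          · exact hMA y fun hyA => hy (Finset.mem_erase.mpr ⟨hyz, hyA⟩)
        | succ m ihm =>
          intro M hM hM0 hMN hMA hzM
          refine .of_colon_of_erase (t := s - 1) hM hz ?_ ?_ (by omega)
          · by_cases hM' : (0 : σ →₀ ℕ) ∈ {a | a + Finsupp.single z 1 ∈ M}
            · exact .of_zero_mem hs (isUpperSet_colon hM z) hM'
            · exact ihm _ (isUpperSet_colon hM z) hM' (fun y => (hMN y).colon)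
                (fun y hy => (hMA y hy).colon) hzM.colon_self
          · refine step _ (isUpperSet_erase hM z) (by simpa using hM0) (fun y => (hMN y).erase)
              fun y hy => ?_
            by_cases hyz : y = z
            · exact hyz ▸ boundedAt_erase_self
            · exact (hMA y fun hyA => hy (Finset.mem_erase.mpr ⟨hyz, hyA⟩)).erase
      exact key N L hL h0 hN hA (hN z)
  · have hGpos : 0 < G.card := Finset.card_pos.mpr ⟨i, hi⟩
    have hmem : ∀ {j}, j ∈ G.erase i → j ∈ G := fun hj => Finset.mem_of_mem_erase hj
    rcases (T i).eq_empty_or_nonempty with hTi | ⟨z, hz⟩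
    -- With `T i` empty, no minimal generator involves `x i`, so the variable and its group are
    -- dropped together.
    · refine (ih _ (Finset.erase_ssubset (hxA i hi)) (G := G.erase i) (T := T) hL h0 hN
        (fun y hy => ?_) ?_ (fun j hj => ?_) (fun j hj y hy => ?_)
        (hxx.mono (by simp)) (fun j hj l hl => hxT j (hmem hj) l (hmem hl))
        (fun j hj l hl => hTT j (hmem hj) l (hmem hl))
        (fun j hj => had j (hmem hj))).mono (Finset.erase_subset _ _) le_rfl
      · by_cases hyx : y = x i
        · subst hyx
          intro a _ ha
          exact (had i hi).of_add_single a (by simp [hTi]) ha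
        · exact hA y fun hyA => hy (Finset.mem_erase.mpr ⟨hyx, hyA⟩)
      · rw [Finset.card_erase_of_mem (hxA i hi), Finset.card_erase_of_mem hi]
        omega
      · exact Finset.mem_erase.mpr ⟨fun e => Finset.ne_of_mem_erase hj
          (hxx (hmem hj) hi e), hxA j (hmem hj)⟩
      · exact Finset.mem_erase.mpr ⟨fun e => hxT i hi j (hmem hj) (e ▸ hy), hTA j (hmem hj) hy⟩
    · have hzA : z ∈ A := hTA i hi hz
      have hzx : ∀ j ∈ G, z ≠ x j := fun j hj e => hxT j hj i hi (e ▸ hz)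
      -- `A` contains z besides the `G.card` distinct variables `x j`.
      have hs : 0 < s := by
        have h1 : G.image x ⊆ A.erase z := by
          intro y hy
          obtain ⟨j, hj, rfl⟩ := Finset.mem_image.mp hy
          exact Finset.mem_erase.mpr ⟨(hzx j hj).symm, hxA j hj⟩
        have h2 := Finset.card_le_card h1
        rw [Finset.card_image_of_injOn hxx, Finset.card_erase_of_mem hzA] at h2
        omega
      refine .of_colon_of_erase (t := s - 1) hL hzA ?_ ?_ (by omega)
      · by_cases hL' : (0 : σ →₀ ℕ) ∈ {a | a + Finsupp.single z 1 ∈ L}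
        · exact .of_zero_mem hs (isUpperSet_colon hL z) hL'
        · have hzT : ∀ j ∈ G.erase i, z ∉ T j := fun j hj hzj =>
            Finset.disjoint_left.mp (hTT i hi j (hmem hj) (Finset.ne_of_mem_erase hj).symm) hz hzj
          -- Degree at most one in z means that z disappears from the colon ideal; losing z from `A`
          -- and i from `G` leaves s unchanged.
          refine (ih _ (Finset.erase_ssubset hzA) (G := G.erase i) (T := T)
            (isUpperSet_colon hL z) hL' (fun y => (hN y).colon)
            (fun y hy => ?_) ?_ (fun j hj => ?_) (fun j hj y hy => ?_)
            (hxx.mono (by simp)) (fun j hj l hl => hxT j (hmem hj) l (hmem hl))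
            (fun j hj l hl => hTT j (hmem hj) l (hmem hl))
            (fun j hj => (had j (hmem hj)).colon (hzT j hj))).mono (Finset.erase_subset _ _) le_rfl
          · by_cases hyz : y = z
            · subst hyz
              intro a _ ha
              exact (had i hi).of_add_single_of_ne_zero y hz _ (by simp) ha
            · exact (hA y fun hyA => hy (Finset.mem_erase.mpr ⟨hyz, hyA⟩)).colon
          · rw [Finset.card_erase_of_mem hzA, Finset.card_erase_of_mem hi]
            omega
          · exact Finset.mem_erase.mpr ⟨(hzx j (hmem hj)).symm, hxA j (hmem hj)⟩
          · exact Finset.mem_erase.mpr ⟨fun e => hzT j hj (e ▸ hy), hTA j (hmem hj) hy⟩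
      · refine ih _ (Finset.erase_ssubset hzA) (G := G) (T := fun j => (T j).erase z)
          (isUpperSet_erase hL z) (by simpa using h0) (fun y => (hN y).erase)
          (fun y hy => ?_) ?_ (fun j hj => ?_) (fun j hj => ?_) hxx
          (fun j hj l hl hjl => hxT j hj l hl (Finset.mem_of_mem_erase hjl))
          (fun j hj l hl hjl => (hTT j hj l hl hjl).mono (Finset.erase_subset _ _)
            (Finset.erase_subset _ _))
          (fun j hj => (had j hj).erase (hzx j hj))
        · by_cases hyz : y = z
          · exact hyz ▸ boundedAt_erase_self
          · exact (hA y fun hyA => hy (Finset.mem_erase.mpr ⟨hyz, hyA⟩)).erase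
        · rw [Finset.card_erase_of_mem hzA]
          omega
        · exact Finset.mem_erase.mpr ⟨(hzx j hj).symm, hxA j hj⟩
        · exact Finset.erase_subset_erase _ (hTA j hj)

/-- Dickson's lemma: the minimal elements form an antichain, hence a finite set. -/
theorem exists_boundedAt [Finite σ] {L : Set (σ →₀ ℕ)} (hL : IsUpperSet L) :
    ∃ N, ∀ y, BoundedAt y N L := by
  have hfin : {a | Minimal (· ∈ L) a}.Finite :=
    WellQuasiOrderedLE.finite_of_isAntichain (setOfPred_minimal_antichain (· ∈ L))
  have hbdd : ∀ y : σ, ∃ N, ∀ a, Minimal (· ∈ L) a → a y ≤ N := fun y => by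
    obtain ⟨N, hN⟩ := (hfin.image fun a => a y).bddAbove
    exact ⟨N, fun a ha => hN ⟨a, ha, rfl⟩⟩
  choose N hN using hbdd
  have := Fintype.ofFinite σ
  refine ⟨Finset.univ.sup N, fun y a hay ha => ?_⟩
  obtain ⟨m, hma, hm⟩ := exists_minimal_le_of_wellFoundedLT (· ∈ L) _ ha
  refine hL (fun z => ?_) hm.1
  by_cases hz : z = y
  · subst hz
    exact (hN z m hm).trans ((Finset.le_sup (Finset.mem_univ z)).trans hay)
  · have := hma z
    simpa [hz] using this

end LinearQuotients

end InitReg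

namespace InitReg

/-! ### Leading positions and Schreyer's order on free modules -/

section Lead

open MvPolynomial

/-- A leading-position function on a module over a polynomial ring: every nonzero element has a
leading position in a linearly ordered set on which the exponent vectors act, and two elements with
the same position differ by a scalar, up to an element with a smaller position. -/
structure LeadFun (σ k X U : Type*) [Field k] [LinearOrder X] [AddCommGroup U]
    [Module (MvPolynomial σ k) U] where
  act : (σ →₀ ℕ) → X → X
  act_add : ∀ a c x, act (a + c) x = act a (act c x)
  act_strictMono : ∀ a, StrictMono (act a)
  act_injective : ∀ x, Function.Injective (act · x)
  lead : U → WithBot X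
  lead_eq_bot : ∀ u, lead u = ⊥ ↔ u = 0
  lead_add_le : ∀ u v, lead (u + v) ≤ max (lead u) (lead v)
  lead_monomial_smul : ∀ (a : σ →₀ ℕ) (c : k) (u : U), c ≠ 0 →
    lead (monomial a c • u) = (lead u).map (act a)
  exists_lead_sub_lt : ∀ u v : U, u ≠ 0 → lead u = lead v →
    ∃ c : k, lead (u - (C c : MvPolynomial σ k) • v) < lead u

namespace LeadFun

variable {σ k X U : Type*} [Field k] [LinearOrder X] [AddCommGroup U]
  [Module (MvPolynomial σ k) U] (lf : LeadFun σ k X U)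

theorem lead_zero : lf.lead 0 = ⊥ := (lf.lead_eq_bot 0).mpr rfl

theorem lead_sum_lt {ι : Type*} {s : Finset ι} {f : ι → U} {y : WithBot X} (hy : ⊥ < y)
    (h : ∀ i ∈ s, lf.lead (f i) < y) : lf.lead (∑ i ∈ s, f i) < y := by
  classical
  induction s using Finset.induction_on with
  | empty => simpa [lf.lead_zero] using hy
  | insert i s hi ih =>
    rw [Finset.sum_insert hi]
    exact (lf.lead_add_le _ _).trans_lt (max_lt (h i (Finset.mem_insert_self _ _))
      (ih fun j hj => h j (Finset.mem_insert_of_mem hj)))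

/-- The restriction of a leading-position function to a submodule. -/
def restrict (K : Submodule (MvPolynomial σ k) U) : LeadFun σ k X K where
  act := lf.act
  act_add := lf.act_add
  act_strictMono := lf.act_strictMono
  act_injective := lf.act_injective
  lead u := lf.lead u
  lead_eq_bot u := by rw [lf.lead_eq_bot, ZeroMemClass.coe_eq_zero]
  lead_add_le u v := lf.lead_add_le u v
  lead_monomial_smul a c u hc := lf.lead_monomial_smul a c u hc
  exists_lead_sub_lt u v hu huv :=
    lf.exists_lead_sub_lt u v (fun h => hu (Subtype.ext h)) huv

end LeadFun

/-- The leading exponent with respect to a monomial order. -/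
noncomputable def leadingExponent {σ : Type*} (k : Type*) [Field k]
    (ord : MonomialOrder σ) : LeadFun σ k ord.syn (MvPolynomial σ k) where
  act a y := ord.toSyn a + y
  act_add a c y := by rw [map_add, add_assoc]
  act_strictMono a y z hyz := by simpa using hyz
  act_injective y a c h := by simpa using h
  lead f := ord.toWithBotSyn (ord.withBotDegree f)
  lead_eq_bot u := by simp [MonomialOrder.withBotDegree_eq_bot_iff]
  lead_add_le u v := MonomialOrder.withBotDegree_add_le u v
  lead_monomial_smul a c u hc := by
    classical
    rw [smul_eq_mul, MonomialOrder.withBotDegree_mul, MonomialOrder.withBotDegree_monomial,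
      if_neg hc]
    cases h : ord.withBotDegree u with
    | bot => simp
    | coe d => simp [← WithBot.coe_add]
  exists_lead_sub_lt u v hu huv := by
    classical
    have huv' := ord.toWithBotSyn.injective huv
    have hv : v ≠ 0 := by
      rw [Ne, ← MonomialOrder.withBotDegree_eq_bot_iff (m := ord), ← huv',
        MonomialOrder.withBotDegree_eq_bot_iff]
      exact hu
    have hcv : ord.leadingCoeff v ≠ 0 := MonomialOrder.leadingCoeff_ne_zero_iff.mpr hv
    refine ⟨ord.leadingCoeff u / ord.leadingCoeff v, ?_⟩
    have hdu := (MonomialOrder.withBotDegree_eq_coe_degree_iff (m := ord) u).mpr hu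
    have hdv := (MonomialOrder.withBotDegree_eq_coe_degree_iff (m := ord) v).mpr hv
    have hdeg : ord.degree u = ord.degree v := by
      rw [hdu, hdv] at huv'
      exact WithBot.coe_injective huv'
    set w := u - (C (ord.leadingCoeff u / ord.leadingCoeff v) : MvPolynomial σ k) • v with hw
    by_cases hw0 : w = 0
    · rw [hw0, MonomialOrder.withBotDegree_zero, hdu]
      simp
    rw [hdu, (MonomialOrder.withBotDegree_eq_coe_degree_iff (m := ord) w).mpr hw0,
      MonomialOrder.toWithBotSyn_apply_coe, MonomialOrder.toWithBotSyn_apply_coe,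
      WithBot.coe_lt_coe]
    have hcoeff : coeff (ord.degree u) w = 0 := by
      rw [hw, coeff_sub, smul_eq_mul, coeff_C_mul, hdeg]
      change coeff _ u - _ * ord.leadingCoeff v = 0
      rw [div_mul_cancel₀ _ hcv, ← hdeg]
      exact sub_self _
    refine lt_of_le_of_ne (MonomialOrder.degree_le_iff.mpr fun a ha => ?_) fun h => ?_
    · rcases Finset.mem_union.mp (support_sub _ _ _ ha) with h | h
      · exact MonomialOrder.le_degree h
      · rw [hdeg]
        refine MonomialOrder.le_degree (m := ord) (f := v) ?_
        rw [mem_support_iff, smul_eq_mul, coeff_C_mul] at h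
        exact mem_support_iff.mpr (right_ne_zero_of_mul h)
    · have := (MonomialOrder.coeff_degree_ne_zero_iff (m := ord)).mpr hw0
      rw [ord.toSyn.injective h] at this
      exact this hcoeff

section Syzygies

variable {σ k X U ι : Type*} [Field k] [LinearOrder X] [AddCommGroup U]
  [Module (MvPolynomial σ k) U] (lf : LeadFun σ k X U) (x : ι → X)

/-- The position of the monomial `x^a` of the `i`-th coordinate of a free module whose `i`-th basis
vector has position `x i`; ties are broken by the index. -/
def basisPosition (i : ι) (a : σ →₀ ℕ) : X ×ₗ ι := toLex (lf.act a (x i), i)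

variable {lf x} in
theorem basisPosition_inj {i j : ι} {a c : σ →₀ ℕ} :
    basisPosition lf x i a = basisPosition lf x j c ↔ i = j ∧ a = c := by
  constructor
  · intro h
    have h2 : i = j := congrArg (fun p => (ofLex p).2) h
    subst h2
    exact ⟨rfl, lf.act_injective (x i) (congrArg (fun p => (ofLex p).1) h)⟩
  · rintro ⟨rfl, rfl⟩
    rfl

variable [LinearOrder ι] [Fintype ι]

/-- The leading position in the free module with basis vectors in positions `x i`. -/
noncomputable def freeLead (h : ι → MvPolynomial σ k) : WithBot (X ×ₗ ι) :=
  Finset.univ.sup fun i => (h i).support.sup fun a => (basisPosition lf x i a : WithBot (X ×ₗ ι))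

variable {lf x}

theorem freeLead_le_iff {h : ι → MvPolynomial σ k} {y : WithBot (X ×ₗ ι)} :
    freeLead lf x h ≤ y ↔ ∀ i a, coeff a (h i) ≠ 0 → (basisPosition lf x i a : WithBot _) ≤ y := by
  simp [freeLead, Finset.sup_le_iff]

theorem le_freeLead {h : ι → MvPolynomial σ k} {i : ι} {a : σ →₀ ℕ} (hc : coeff a (h i) ≠ 0) :
    (basisPosition lf x i a : WithBot _) ≤ freeLead lf x h :=
  freeLead_le_iff.mp le_rfl i a hc

theorem exists_freeLead_eq {h : ι → MvPolynomial σ k} (hh : h ≠ 0) :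
    ∃ i a, coeff a (h i) ≠ 0 ∧ freeLead lf x h = basisPosition lf x i a := by
  obtain ⟨i₀, hi₀⟩ := Function.ne_iff.mp hh
  obtain ⟨a₀, ha₀⟩ := ne_zero_iff.mp hi₀
  obtain ⟨i, -, hi⟩ := Finset.exists_mem_eq_sup Finset.univ ⟨i₀, Finset.mem_univ _⟩
    fun i => (h i).support.sup fun a => (basisPosition lf x i a : WithBot (X ×ₗ ι))
  by_cases hs : (h i).support.Nonempty
  · obtain ⟨a, ha, hia⟩ := Finset.exists_mem_eq_sup _ hs
      fun a => (basisPosition lf x i a : WithBot (X ×ₗ ι))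
    exact ⟨i, a, mem_support_iff.mp ha, hi.trans hia⟩
  · have := le_freeLead (lf := lf) (x := x) ha₀
    rw [freeLead, hi, Finset.not_nonempty_iff_eq_empty.mp hs, Finset.sup_empty] at this
    simp at this

theorem freeLead_eq {h : ι → MvPolynomial σ k} {i : ι} {a : σ →₀ ℕ} (hc : coeff a (h i) ≠ 0)
    (hle : ∀ j c, coeff c (h j) ≠ 0 → basisPosition lf x j c ≤ basisPosition lf x i a) :
    freeLead lf x h = basisPosition lf x i a :=
  le_antisymm (freeLead_le_iff.mpr fun j c hjc => WithBot.coe_le_coe.mpr (hle j c hjc))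
    (le_freeLead hc)

theorem freeLead_eq_bot {h : ι → MvPolynomial σ k} : freeLead lf x h = ⊥ ↔ h = 0 := by
  constructor
  · intro hb
    by_contra hh
    obtain ⟨i, a, -, he⟩ := exists_freeLead_eq (lf := lf) (x := x) hh
    rw [hb] at he
    exact WithBot.bot_ne_coe he
  · rintro rfl
    rw [eq_bot_iff, freeLead_le_iff]
    simp

variable (lf x)

/-- The leading-position function of a free module with basis vectors in positions `x i`. -/
noncomputable def freeLeadFun : LeadFun σ k (X ×ₗ ι) (ι → MvPolynomial σ k) where
  act a y := toLex (lf.act a (ofLex y).1, (ofLex y).2)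
  act_add a c y := by simp [lf.act_add]
  act_strictMono a y z hyz := by
    rw [Prod.Lex.lt_iff] at hyz ⊢
    rcases hyz with h | ⟨h, h'⟩
    · exact .inl (lf.act_strictMono a h)
    · exact .inr ⟨congrArg (lf.act a) h, h'⟩
  act_injective y a c h := lf.act_injective (ofLex y).1 (congrArg (fun p => (ofLex p).1) h)
  lead := freeLead lf x
  lead_eq_bot _ := freeLead_eq_bot
  lead_add_le u v := by
    refine freeLead_le_iff.mpr fun i a hc => ?_
    rw [Pi.add_apply, coeff_add] at hc
    by_cases hu : coeff a (u i) = 0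
    · exact (le_freeLead (by simpa [hu] using hc)).trans (le_max_right _ _)
    · exact (le_freeLead hu).trans (le_max_left _ _)
  lead_monomial_smul a c u hc := by
    by_cases hu : u = 0
    · rw [hu, smul_zero, freeLead_eq_bot.mpr rfl]
      rfl
    · obtain ⟨i, d, hid, he⟩ := exists_freeLead_eq (lf := lf) (x := x) hu
      have hpos : ∀ j e, basisPosition lf x j (a + e) =
          toLex (lf.act a (ofLex (basisPosition lf x j e)).1, (ofLex (basisPosition lf x j e)).2) :=
        fun j e => by simp [basisPosition, lf.act_add]
      rw [he, WithBot.map_coe, ← hpos]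
      refine freeLead_eq ?_ fun j e hje => ?_
      · rw [Pi.smul_apply, smul_eq_mul, coeff_monomial_mul]
        exact mul_ne_zero hc hid
      · rw [Pi.smul_apply, smul_eq_mul, coeff_monomial_mul'] at hje
        split_ifs at hje with hae
        · obtain ⟨f, rfl⟩ := exists_add_of_le hae
          rw [add_tsub_cancel_left] at hje
          have hle := le_freeLead (lf := lf) (x := x) (right_ne_zero_of_mul hje)
          rw [he, WithBot.coe_le_coe, Prod.Lex.le_iff] at hle
          rw [hpos, hpos, Prod.Lex.le_iff]
          rcases hle with h | ⟨h, h'⟩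
          · exact .inl (lf.act_strictMono a h)
          · exact .inr ⟨congrArg (lf.act a) h, h'⟩
        · exact absurd rfl hje
  exists_lead_sub_lt u v hu huv := by
    have hv : v ≠ 0 := by
      rw [Ne, ← freeLead_eq_bot (lf := lf) (x := x), ← huv, freeLead_eq_bot]
      exact hu
    obtain ⟨i, a, hia, he⟩ := exists_freeLead_eq (lf := lf) (x := x) hu
    obtain ⟨j, c, hjc, he'⟩ := exists_freeLead_eq (lf := lf) (x := x) hv
    have heq := he.symm.trans (huv.trans he')
    rw [WithBot.coe_inj, basisPosition_inj] at heq
    obtain ⟨rfl, rfl⟩ := heq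
    refine ⟨coeff a (u i) / coeff a (v i), ?_⟩
    have hcoeff : ∀ l e,
        coeff e ((u - (C (coeff a (u i) / coeff a (v i)) : MvPolynomial σ k) • v) l) =
        coeff e (u l) - coeff a (u i) / coeff a (v i) * coeff e (v l) := fun l e => by
      rw [Pi.sub_apply, Pi.smul_apply, smul_eq_mul, coeff_sub, coeff_C_mul]
    set w := u - (C (coeff a (u i) / coeff a (v i)) : MvPolynomial σ k) • v with hw
    by_cases hw0 : w = 0
    · rw [hw0, freeLead_eq_bot.mpr rfl, he]
      exact WithBot.bot_lt_coe _
    · obtain ⟨l, e, hle, hwe⟩ := exists_freeLead_eq (lf := lf) (x := x) hw0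
      rw [hwe]
      refine lt_of_le_of_ne ?_ fun h => ?_
      · rw [hcoeff] at hle
        by_cases hul : coeff e (u l) = 0
        · rw [huv]
          refine le_freeLead fun hvl => hle ?_
          rw [hul, hvl, mul_zero, sub_zero]
        · exact le_freeLead hul
      · rw [he, WithBot.coe_inj, basisPosition_inj] at h
        obtain ⟨rfl, rfl⟩ := h
        rw [hcoeff, div_mul_cancel₀ _ hjc, sub_self] at hle
        exact hle rfl

end Syzygies

end Lead

end InitReg

namespace InitReg

/-! ### Syzygies of modules with linear quotients -/

section LeadQuotients

open MvPolynomial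

/-- The leading positions of `lf` are generated by the positions `x i`, and the positions generated
by `x j` with `j < i` meet those generated by `x i` in the multiples of the variables of `Z i`,
which number fewer than `s`. -/
structure LeadFun.LinearQuotients {σ k X U : Type*} [Field k] [LinearOrder X] [AddCommGroup U]
    [Module (MvPolynomial σ k) U] (lf : LeadFun σ k X U) {ι : Type*} [LinearOrder ι] (x : ι → X)
    (Z : ι → Finset σ) (s : ℕ) : Prop where
  exists_lead : ∀ i, ∃ u, lf.lead u = x i
  exists_act : ∀ u ≠ 0, ∃ i a, lf.lead u = lf.act a (x i)
  colon_iff : ∀ i u, (∃ j < i, ∃ a, lf.act u (x i) = lf.act a (x j)) ↔ ∃ z ∈ Z i, u z ≠ 0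
  card_lt : ∀ i, (Z i).card < s

variable {σ k X U ι : Type*} [Field k] [LinearOrder X] [AddCommGroup U]
  [Module (MvPolynomial σ k) U] {lf : LeadFun σ k X U} {x : ι → X}
  {Z : ι → Finset σ} {s : ℕ} {g : ι → U}

theorem lead_monomial_smul_eq (hg : ∀ i, lf.lead (g i) = x i) {c : k} (hc : c ≠ 0) (a : σ →₀ ℕ)
    (i : ι) : lf.lead (monomial a c • g i) = lf.act a (x i) := by
  rw [lf.lead_monomial_smul a c _ hc, hg, WithBot.map_coe]

theorem linearCombination_eq_sum_monomial_smul [Fintype ι] (h : ι → MvPolynomial σ k) :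
    Fintype.linearCombination (MvPolynomial σ k) g h =
      ∑ p ∈ Finset.univ.sigma fun i => (h i).support, monomial p.2 (coeff p.2 (h p.1)) • g p.1 := by
  rw [Finset.sum_sigma, Fintype.linearCombination_apply]
  refine Finset.sum_congr rfl fun i _ => ?_
  conv_lhs => rw [← support_sum_monomial_coeff (h i), Finset.sum_smul]

variable [LinearOrder ι] [Fintype ι]

/-- Every element is a combination of the `g i` without cancellation of leading positions. -/
theorem LeadFun.LinearQuotients.exists_representation [WellFoundedLT X]
    (hq : lf.LinearQuotients x Z s) (hg : ∀ i, lf.lead (g i) = x i) (u : U) :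
    ∃ h : ι → MvPolynomial σ k, Fintype.linearCombination (MvPolynomial σ k) g h = u ∧
      ∀ i a, coeff a (h i) ≠ 0 → (lf.act a (x i) : WithBot X) ≤ lf.lead u := by
  classical
  induction hl : lf.lead u using WellFoundedLT.induction generalizing u with
  | ind y ih =>
  subst hl
  by_cases hu : u = 0
  · exact ⟨0, by simp [hu], by simp⟩
  obtain ⟨i, a, hia⟩ := hq.exists_act u hu
  have hm := lead_monomial_smul_eq hg (one_ne_zero (α := k)) a i
  obtain ⟨c, hc⟩ := lf.exists_lead_sub_lt u _ hu (hia.trans hm.symm)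
  obtain ⟨h, hh, hle⟩ := ih _ hc _ rfl
  refine ⟨h + Pi.single i (monomial a c), ?_, fun j e hje => ?_⟩
  · rw [map_add, hh, Fintype.linearCombination_apply_single, smul_smul, C_mul_monomial, mul_one,
      sub_add_cancel]
  · by_cases hj : coeff e (h j) = 0
    · rw [Pi.add_apply, coeff_add, hj, zero_add] at hje
      by_cases hij : j = i
      · subst hij
        rw [Pi.single_eq_same, coeff_monomial] at hje
        have : a = e := by
          by_contra hne
          simp [hne] at hje
        rw [← this, hia]
      · simp [Pi.single_eq_of_ne hij] at hje
    · exact (hle j e hj).trans hc.le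

/-- The leading monomial of a syzygy is divisible by a variable of `Z i`. -/
theorem LeadFun.LinearQuotients.exists_mem_of_ker (hq : lf.LinearQuotients x Z s)
    (hg : ∀ i, lf.lead (g i) = x i) {h : ι → MvPolynomial σ k}
    (hker : Fintype.linearCombination (MvPolynomial σ k) g h = 0) {i : ι} {a : σ →₀ ℕ}
    (hc : coeff a (h i) ≠ 0) (hlead : freeLead lf x h = basisPosition lf x i a) :
    ∃ z ∈ Z i, a z ≠ 0 := by
  classical
  by_contra hne
  -- If no smaller index reaches the position of x^a g_i, the tie-break makes that position strictly
  -- larger than all others in the sum, so the term cannot cancel.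
  rw [← hq.colon_iff] at hne
  rw [linearCombination_eq_sum_monomial_smul] at hker
  have hmem : (⟨i, a⟩ : Σ _ : ι, σ →₀ ℕ) ∈ Finset.univ.sigma fun i => (h i).support := by
    simpa using hc
  rw [← Finset.add_sum_erase _ _ hmem] at hker
  have hlt : lf.lead (∑ p ∈ (Finset.univ.sigma fun i => (h i).support).erase ⟨i, a⟩,
      monomial p.2 (-coeff p.2 (h p.1)) • g p.1) < (lf.act a (x i) : WithBot X) := by
    refine lf.lead_sum_lt (WithBot.bot_lt_coe _) ?_
    rintro ⟨j, e⟩ hje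
    obtain ⟨hne', hje⟩ := Finset.mem_erase.mp hje
    have hje : coeff e (h j) ≠ 0 := by simpa using hje
    rw [lead_monomial_smul_eq hg (neg_ne_zero.mpr hje), WithBot.coe_lt_coe]
    have hle := le_freeLead (lf := lf) (x := x) hje
    rw [hlead, WithBot.coe_le_coe, Prod.Lex.le_iff] at hle
    rcases hle with hlt | ⟨heq, hji⟩
    · exact hlt
    · exfalso
      rcases lt_or_eq_of_le hji with hji | hji
      · exact hne ⟨j, hji, e, heq.symm⟩
      · have hji : j = i := hji
        subst hji
        exact hne' (by rw [lf.act_injective (x j) heq])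
  have heq : monomial a (coeff a (h i)) • g i =
      ∑ p ∈ (Finset.univ.sigma fun i => (h i).support).erase ⟨i, a⟩,
        monomial p.2 (-coeff p.2 (h p.1)) • g p.1 := by
    rw [eq_neg_of_add_eq_zero_left hker, ← Finset.sum_neg_distrib]
    refine Finset.sum_congr rfl fun p _ => ?_
    rw [map_neg, neg_smul]
  rw [← heq, lead_monomial_smul_eq hg hc] at hlt
  exact lt_irrefl _ hlt

/-- Every variable of `Z i` is the leading monomial of a syzygy. -/
theorem LeadFun.LinearQuotients.exists_syzygy [WellFoundedLT X] (hq : lf.LinearQuotients x Z s)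
    (hg : ∀ i, lf.lead (g i) = x i) {i : ι} {z : σ} (hz : z ∈ Z i) :
    ∃ h : ι → MvPolynomial σ k, Fintype.linearCombination (MvPolynomial σ k) g h = 0 ∧
      freeLead lf x h = basisPosition lf x i (Finsupp.single z 1) := by
  classical
  obtain ⟨j, hji, a, ha⟩ := (hq.colon_iff i (Finsupp.single z 1)).mpr ⟨z, hz, by simp⟩
  have h1 := lead_monomial_smul_eq hg (one_ne_zero (α := k)) (Finsupp.single z 1) i
  have h2 := lead_monomial_smul_eq hg (one_ne_zero (α := k)) a j
  have hne : monomial (Finsupp.single z 1) (1 : k) • g i ≠ 0 := by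
    rw [Ne, ← lf.lead_eq_bot, h1]
    exact WithBot.coe_ne_bot
  -- The analogue of an S-pair: z g_i and c x^a g_j have the same position, and their difference is
  -- a combination of the g's in smaller positions.
  obtain ⟨c, hc⟩ := lf.exists_lead_sub_lt _ (monomial a (1 : k) • g j) hne (by rw [h1, h2, ha])
  obtain ⟨h, hh, hle⟩ := hq.exists_representation hg
    (monomial (Finsupp.single z 1) (1 : k) • g i - (C c : MvPolynomial σ k) •
      monomial a (1 : k) • g j)
  have hlt : ∀ l e, coeff e (h l) ≠ 0 → lf.act e (x l) < lf.act (Finsupp.single z 1) (x i) := by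
    intro l e hl
    have := (hle l e hl).trans_lt hc
    rwa [h1, WithBot.coe_lt_coe] at this
  refine ⟨Pi.single i (monomial (Finsupp.single z 1) 1) - Pi.single j (monomial a c) - h, ?_,
    freeLead_eq ?_ fun l e hl => ?_⟩
  · rw [map_sub, map_sub, hh, Fintype.linearCombination_apply_single,
      Fintype.linearCombination_apply_single, smul_smul, C_mul_monomial, mul_one, sub_self]
  · have h0 : coeff (Finsupp.single z 1) (h i) = 0 := by
      by_contra hne
      exact lt_irrefl _ (hlt i _ hne)
    simp [h0, Pi.single_eq_of_ne hji.ne']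
  · by_cases hl0 : coeff e (h l) = 0
    · simp only [Pi.sub_apply, coeff_sub, hl0, sub_zero] at hl
      by_cases hli : l = i
      · subst hli
        rw [Pi.single_eq_same, Pi.single_eq_of_ne hji.ne', coeff_zero, sub_zero,
          coeff_monomial] at hl
        have : Finsupp.single z 1 = e := by
          by_contra hne
          simp [hne] at hl
        rw [this]
      · rw [Pi.single_eq_of_ne hli, coeff_zero, zero_sub, neg_ne_zero] at hl
        by_cases hlj : l = j
        · subst hlj
          rw [Pi.single_eq_same, coeff_monomial] at hl
          have : a = e := by
            by_contra hne
            simp [hne] at hl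
          rw [← this, Prod.Lex.le_iff]
          -- The two terms of the S-pair tie in `X`; the larger index i decides.
          exact .inr ⟨ha.symm, hji.le⟩
        · simp [Pi.single_eq_of_ne hlj] at hl
    · rw [Prod.Lex.le_iff]
      exact .inl (hlt l e hl0)

/-- The pairs of an index `i` and a variable of `Z i`. -/
abbrev SyzygyIndex (Z : ι → Finset σ) : Type _ :=
  {p : ι ×ₗ σ // (ofLex p).2 ∈ Z (ofLex p).1}

/-- The syzygies of a family with linear quotients have linear quotients by fewer variables. -/
theorem LeadFun.LinearQuotients.syzygies [LinearOrder σ] [WellFoundedLT X]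
    (hq : lf.LinearQuotients x Z (s + 1)) (hg : ∀ i, lf.lead (g i) = x i) :
    ((freeLeadFun lf x).restrict
      (LinearMap.ker (Fintype.linearCombination (MvPolynomial σ k) g))).LinearQuotients
      (fun p : SyzygyIndex Z =>
        basisPosition lf x (ofLex p.1).1 (Finsupp.single (ofLex p.1).2 1))
      (fun p => (Z (ofLex p.1).1).filter (· < (ofLex p.1).2)) s where
  exists_lead := by
    rintro ⟨p, hp⟩
    obtain ⟨h, hker, hlead⟩ := hq.exists_syzygy hg hp
    exact ⟨⟨h, hker⟩, hlead⟩
  exists_act := by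
    rintro ⟨h, hker⟩ hne
    obtain ⟨i, a, hc, hlead⟩ :=
      exists_freeLead_eq (lf := lf) (x := x) (fun e => hne (Subtype.ext e) : h ≠ 0)
    obtain ⟨z, hz, haz⟩ := hq.exists_mem_of_ker hg hker hc hlead
    refine ⟨⟨toLex (i, z), hz⟩, a - Finsupp.single z 1, hlead.trans ?_⟩
    have hle : Finsupp.single z 1 ≤ a := by
      rw [Finsupp.single_le_iff]
      omega
    rw [WithBot.coe_inj]
    change toLex (lf.act a (x i), i) =
      toLex (lf.act (a - Finsupp.single z 1) (lf.act (Finsupp.single z 1) (x i)), i)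
    rw [← lf.act_add, tsub_add_cancel_of_le hle]
  colon_iff := by
    rintro ⟨p, hp⟩ u
    obtain ⟨⟨i, z⟩, rfl⟩ := toLex.surjective p
    change z ∈ Z i at hp
    constructor
    · rintro ⟨⟨p', hp'⟩, hlt, a, ha⟩
      obtain ⟨⟨j, w⟩, rfl⟩ := toLex.surjective p'
      change w ∈ Z j at hp'
      change toLex (lf.act u (lf.act (Finsupp.single z 1) (x i)), i) =
        toLex (lf.act a (lf.act (Finsupp.single w 1) (x j)), j) at ha
      -- Positions with different basis indices never coincide, so only variables w < z of the same
      -- `Z i` matter.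
      have hij : i = j := congrArg (fun p => (ofLex p).2) ha
      subst hij
      have ha' := congrArg (fun p => (ofLex p).1) ha
      simp only [ofLex_toLex, ← lf.act_add] at ha'
      have huw := DFunLike.congr_fun (lf.act_injective (x i) ha') w
      have hwz : w < z := by
        change toLex (i, w) < toLex (i, z) at hlt
        simpa [Prod.Lex.lt_iff] using hlt
      refine ⟨w, Finset.mem_filter.mpr ⟨hp', hwz⟩, ?_⟩
      simp only [Finsupp.add_apply, Finsupp.single_eq_same,
        Finsupp.single_eq_of_ne hwz.ne] at huw
      omega
    · rintro ⟨w, hw, huw⟩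
      obtain ⟨hwZ, hwz⟩ := Finset.mem_filter.mp hw
      change w < z at hwz
      refine ⟨⟨toLex (i, w), hwZ⟩, ?_, u - Finsupp.single w 1 + Finsupp.single z 1, ?_⟩
      · change toLex (i, w) < toLex (i, z)
        simpa [Prod.Lex.lt_iff] using hwz
      · change toLex (lf.act u (lf.act (Finsupp.single z 1) (x i)), i) =
          toLex (lf.act (u - Finsupp.single w 1 + Finsupp.single z 1)
            (lf.act (Finsupp.single w 1) (x i)), i)
        have hle : Finsupp.single w 1 ≤ u := by
          rw [Finsupp.single_le_iff]
          omega
        rw [← lf.act_add, ← lf.act_add, add_right_comm, tsub_add_cancel_of_le hle]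
  card_lt := by
    rintro ⟨p, hp⟩
    -- The filter omits z itself, so one variable is lost.
    refine Nat.lt_of_lt_of_le (Finset.card_lt_card ?_) (Nat.lt_succ_iff.mp (hq.card_lt (ofLex p).1))
    exact Finset.filter_ssubset.mpr ⟨_, hp, lt_irrefl _⟩

end LeadQuotients

/-! ### Vanishing of Ext by dimension shifting -/

section Ext

open CategoryTheory Abelian MvPolynomial

universe u

/-- The identity of R^ι is a finite sum of maps factoring through R. -/
theorem subsingleton_ext_pi {R : Type u} [CommRing R] (N : ModuleCat.{u} R) (d : ℕ)
    (hR : Subsingleton (Ext N (ModuleCat.of R R) d)) (ι : Type) [Fintype ι] :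
    Subsingleton (Ext N (ModuleCat.of R (ι → R)) d) := by
  classical
  refine subsingleton_of_forall_eq 0 fun y => ?_
  have hid : 𝟙 (ModuleCat.of R (ι → R)) = ∑ i, ModuleCat.ofHom (LinearMap.proj i) ≫
      ModuleCat.ofHom (LinearMap.single R (fun _ : ι => R) i) := by
    refine ModuleCat.hom_ext (LinearMap.ext fun v => ?_)
    rw [ModuleCat.hom_sum, LinearMap.sum_apply]
    exact (Finset.univ_sum_single v).symm
  rw [← Ext.comp_mk₀_id y, hid, Ext.mk₀_sum, Ext.comp_sum]
  refine Finset.sum_eq_zero fun i _ => ?_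
  rw [← Ext.mk₀_comp_mk₀, ← Ext.comp_assoc_of_third_deg_zero,
    Subsingleton.elim (y.comp (Ext.mk₀ (ModuleCat.ofHom (LinearMap.proj i))) (add_zero d)) 0,
    Ext.zero_comp]

theorem subsingleton_ext_of_surjective {R : Type u} [CommRing R] (N : ModuleCat.{u} R) (d : ℕ)
    {M P : Type u} [AddCommGroup M] [Module R M] [AddCommGroup P] [Module R P] {f : M →ₗ[R] P}
    (hf : Function.Surjective f) (hM : Subsingleton (Ext N (ModuleCat.of R M) d))
    (hK : Subsingleton (Ext N (ModuleCat.of R (LinearMap.ker f)) (d + 1))) :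
    Subsingleton (Ext N (ModuleCat.of R P) d) := by
  refine subsingleton_of_forall_eq 0 fun y => ?_
  obtain ⟨w, hw⟩ := Ext.covariant_sequence_exact₃ N (LinearMap.shortExact_shortComplexKer hf) y rfl
    (hK.elim _ _)
  rw [← hw, hM.elim w 0, Ext.zero_comp]

/-- Passing to the syzygies trades one unit of s for one unit of d, so d + s ≤ n persists; for s = 0
there are no generators and the module is zero. -/
theorem subsingleton_ext_of_linearQuotients {k : Type u} [Field k] {σ : Type} [LinearOrder σ]
    [Finite σ] (N : ModuleCat.{u} (MvPolynomial σ k)) {n : ℕ}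
    (hR : ∀ d < n, Subsingleton (Ext N (ModuleCat.of _ (MvPolynomial σ k)) d))
    {s : ℕ} {X : Type*} [LinearOrder X] [WellFoundedLT X] {U : Type u} [AddCommGroup U]
    [Module (MvPolynomial σ k) U] {lf : LeadFun σ k X U} {ι : Type} [LinearOrder ι] [Finite ι]
    {x : ι → X} {Z : ι → Finset σ} (hq : lf.LinearQuotients x Z s) {d : ℕ} (hd : d + s ≤ n) :
    Subsingleton (Ext N (ModuleCat.of (MvPolynomial σ k) U) d) := by
  induction s generalizing X U ι d with
  | zero =>
    have hU : Subsingleton U := subsingleton_of_forall_eq 0 fun u => by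
      by_contra hu
      obtain ⟨i, -⟩ := hq.exists_act u hu
      exact absurd (hq.card_lt i) (Nat.not_lt_zero _)
    have hz := ModuleCat.isZero_of_subsingleton (ModuleCat.of (MvPolynomial σ k) U)
    refine subsingleton_of_forall_eq 0 fun y => ?_
    rw [← Ext.comp_mk₀_id y, hz.eq_of_src (𝟙 _) 0, Ext.mk₀_zero, Ext.comp_zero]
  | succ s ih =>
    have := Fintype.ofFinite ι
    have : Finite (ι ×ₗ σ) := inferInstanceAs (Finite (ι × σ))
    choose g hg using hq.exists_lead
    have hsurj : Function.Surjective (Fintype.linearCombination (MvPolynomial σ k) g) := fun u =>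
      (hq.exists_representation hg u).imp fun _ h => h.1
    refine subsingleton_ext_of_surjective N d hsurj
      (subsingleton_ext_pi N d (hR d (by omega)) ι) (ih (hq.syzygies hg) (by omega))

end Ext

end InitReg

namespace InitReg

/-! ### Regular sequences in the maximal ideals of a polynomial ring -/

section RegularSequences

open RingTheory.Sequence

/-- Every maximal ideal contains a weakly regular sequence of length `n`. -/
def HasRegularSequences (B : Type*) [CommRing B] (n : ℕ) : Prop :=
  ∀ m : Ideal B, m.IsMaximal → ∃ rs : List B, rs.length = n ∧ (∀ r ∈ rs, r ∈ m) ∧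
    IsWeaklyRegular B rs

theorem HasRegularSequences.of_ringEquiv {B B' : Type*} [CommRing B] [CommRing B'] {n : ℕ}
    (h : HasRegularSequences B n) (e : B ≃+* B') : HasRegularSequences B' n := by
  intro m hm
  obtain ⟨rs, hlen, hmem, hreg⟩ := h (m.comap e) (Ideal.comap_isMaximal_of_equiv e)
  refine ⟨rs.map e, by simpa using hlen, fun r hr => ?_, ?_⟩
  · obtain ⟨r, hr', rfl⟩ := List.mem_map.mp hr
    exact hmem r hr'
  · refine (AddEquiv.isWeaklyRegular_congr (e := e.toAddEquiv) ?_).mp hreg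
    refine List.forall₂_map_right_iff.mpr (List.forall₂_same.mpr fun r _ y => ?_)
    simp

/-- A monic polynomial remains monic over B/Q, hence is a nonzerodivisor there. -/
theorem isSMulRegular_quotient_map_C {B : Type*} [CommRing B] (Q : Ideal B) {p : Polynomial B}
    (hp : p.Monic) : IsSMulRegular (Polynomial B ⧸ Q.map Polynomial.C) p := by
  refine (isSMulRegular_quotient_iff_mem_of_smul_mem _ _).mpr fun f hf => ?_
  have key : ∀ g : Polynomial B,
      g ∈ Q.map Polynomial.C ↔ g.map (Ideal.Quotient.mk Q) = 0 := fun g => by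
    rw [Ideal.mem_map_C_iff, Polynomial.ext_iff]
    simp [Ideal.Quotient.eq_zero_iff_mem]
  rw [key, smul_eq_mul, Polynomial.map_mul, (hp.map _).mul_right_eq_zero_iff] at hf
  exact (key f).mpr hf

/-- Over a Jacobson ring, m contracts to a maximal ideal of B and the class of X in B[X]/m is
integral over B. An integral equation is a monic polynomial in m, which extends the regular sequence
inherited from B by flatness. -/
theorem HasRegularSequences.polynomial {B : Type*} [CommRing B] [IsJacobsonRing B] {n : ℕ}
    (h : HasRegularSequences B n) : HasRegularSequences (Polynomial B) (n + 1) := by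
  intro m hm
  obtain ⟨rs, hlen, hmem, hreg⟩ := h (m.comap Polynomial.C)
    (Polynomial.isMaximal_comap_C_of_isJacobsonRing m)
  obtain ⟨p, hp, hpm⟩ :=
    Polynomial.quotient_mk_comp_C_isIntegral_of_isJacobsonRing m
      (Ideal.Quotient.mk m Polynomial.X)
  have hpm' : p ∈ m := by
    rw [← Ideal.Quotient.eq_zero_iff_mem, ← hpm, ← Polynomial.hom_eval₂, Polynomial.eval₂_C_X]
  refine ⟨rs.map Polynomial.C ++ [p], by simp [hlen], fun r hr => ?_, ?_⟩
  · rcases List.mem_append.mp hr with hr | hr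
    · obtain ⟨r, hr', rfl⟩ := List.mem_map.mp hr
      exact hmem r hr'
    · rw [List.mem_singleton.mp hr]
      exact hpm'
  · rw [isWeaklyRegular_append_iff]
    refine ⟨hreg.of_flat, ?_⟩
    rw [isWeaklyRegular_singleton_iff, ← Ideal.map_ofList, smul_eq_mul, Ideal.mul_top]
    exact isSMulRegular_quotient_map_C _ hp

theorem hasRegularSequences_mvPolynomial (k : Type*) [Field k] (n : ℕ) :
    HasRegularSequences (MvPolynomial (Fin n) k) n := by
  induction n with
  | zero => exact fun _ _ => ⟨[], rfl, by simp, .nil _ _⟩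
  | succ n ih => exact ih.polynomial.of_ringEquiv (MvPolynomial.finSuccEquiv k n).symm.toRingEquiv

open CategoryTheory Abelian in
theorem subsingleton_ext_quotient_maximal {k : Type*} [Field k] {n : ℕ}
    (m : Ideal (MvPolynomial (Fin n) k)) (hm : m.IsMaximal) {d : ℕ} (hd : d < n) :
    Subsingleton (Ext (ModuleCat.of (MvPolynomial (Fin n) k) (MvPolynomial (Fin n) k ⧸ m))
      (ModuleCat.of (MvPolynomial (Fin n) k) (MvPolynomial (Fin n) k)) d) := by
  obtain ⟨rs, hlen, hmem, hreg⟩ := hasRegularSequences_mvPolynomial k n m hm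
  have hmt : m • (⊤ : Ideal (MvPolynomial (Fin n) k)) ≠ ⊤ := by
    rw [smul_eq_mul, Ideal.mul_top]
    exact hm.ne_top
  refine ModuleCat.subsingleton_ext_of_exists_isRegular m _ ?_ (ModuleCat.of _ _) hmt.lt_top rs
    hmem ⟨hreg, fun h => hmt (top_le_iff.mp (h.le.trans ?_))⟩ d (by omega)
  · rw [Module.support_eq_zeroLocus, Ideal.annihilator_quotient]
  · exact Submodule.smul_mono_left (Ideal.span_le.mpr hmem)

end RegularSequences

/-! ### The depth bound -/

section Depth

open MvPolynomial

theorem HasLinearQuotients.exists_fin {σ : Type*} {A : Finset σ} {s : ℕ} {L : Set (σ →₀ ℕ)}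
    (h : HasLinearQuotients A s L) :
    ∃ (r : ℕ) (x : Fin r → σ →₀ ℕ) (Z : Fin r → Finset σ), (∀ i, (Z i).card < s) ∧
      (∀ a, a ∈ L ↔ ∃ i, x i ≤ a) ∧
      ∀ i u, (∃ j < i, x j ≤ x i + u) ↔ ∃ z ∈ Z i, u z ≠ 0 := by
  induction h with
  | empty => exact ⟨0, Fin.elim0, Fin.elim0, fun i => i.elim0, by simp, fun i => i.elim0⟩
  | @add L a Z _ _ hZ h ih =>
    obtain ⟨r, x, Y, hY, hx, hcolon⟩ := ih
    refine ⟨r + 1, Fin.snoc x a, Fin.snoc Y Z, fun i => ?_, fun c => ?_, fun i u => ?_⟩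
    · induction i using Fin.lastCases with
      | last => simpa using hZ
      | cast i => simpa using hY i
    · simp [Fin.exists_fin_succ', hx]
    · induction i using Fin.lastCases with
      | last => simp [Fin.exists_fin_succ', ← h, hx, Fin.castSucc_lt_last]
      | cast i => simpa [Fin.exists_fin_succ', Fin.not_lt.mpr (Fin.le_last _)] using hcolon i u

theorem exists_linearQuotients {σ k : Type*} [Field k] {ord : MonomialOrder σ}
    {I : Ideal (MvPolynomial σ k)} {A : Finset σ} {s : ℕ}
    (h : HasLinearQuotients A s (exponents (ini ord I))) :
    ∃ (r : ℕ) (x : Fin r → ord.syn) (Z : Fin r → Finset σ),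
      ((leadingExponent k ord).restrict I).LinearQuotients x Z s := by
  obtain ⟨r, x, Z, hZ, hx, hcolon⟩ := h.exists_fin
  refine ⟨r, fun i => ord.toSyn (x i), Z, ⟨fun i => ?_, ?_, fun i u => ?_, hZ⟩⟩
  · obtain ⟨f, hf, hf0, hdeg⟩ := monomial_mem_ini_iff.mp ((hx (x i)).mpr ⟨i, le_rfl⟩)
    refine ⟨⟨f, hf⟩, ?_⟩
    change ord.toWithBotSyn (ord.withBotDegree f) = _
    rw [(MonomialOrder.withBotDegree_eq_coe_degree_iff f).mpr hf0, hdeg,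
      MonomialOrder.toWithBotSyn_apply_coe]
  · rintro ⟨f, hf⟩ hne
    have hf0 : f ≠ 0 := fun e => hne (Subtype.ext e)
    obtain ⟨i, hi⟩ := (hx (ord.degree f)).mp (monomial_mem_ini_iff.mpr ⟨f, hf, hf0, rfl⟩)
    refine ⟨i, ord.degree f - x i, ?_⟩
    change ord.toWithBotSyn (ord.withBotDegree f) =
      ((ord.toSyn (ord.degree f - x i) + ord.toSyn (x i) : ord.syn) : WithBot ord.syn)
    rw [(MonomialOrder.withBotDegree_eq_coe_degree_iff f).mpr hf0,
      MonomialOrder.toWithBotSyn_apply_coe, ← map_add, tsub_add_cancel_of_le hi]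
  · rw [← hcolon i u]
    refine exists_congr fun j => and_congr_right fun _ => ?_
    change (∃ a, ord.toSyn u + ord.toSyn (x i) = ord.toSyn a + ord.toSyn (x j)) ↔ _
    simp only [← map_add, EmbeddingLike.apply_eq_iff_eq]
    rw [le_iff_exists_add']
    simp only [add_comm u]

/-- The sequence 0 → I → R → R/I shifts the degree once more: d < q gives (d + 1) + s ≤ n, as needed
for Ext into I. -/
theorem le_depth_of_hasLinearQuotients {k : Type*} [Field k] {n : ℕ}
    {I : Ideal (MvPolynomial (Fin n) k)} {ord : MonomialOrder (Fin n)} {A : Finset (Fin n)}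
    {s q : ℕ} (hs : s + q ≤ n) (h : HasLinearQuotients A s (exponents (ini ord I))) :
    (q : ℕ∞) ≤ depth (MvPolynomial (Fin n) k) (MvPolynomial (Fin n) k ⧸ I) := by
  refine le_iInf fun m => le_iInf₂ fun d hd => ?_
  by_contra hlt
  rw [not_le, Nat.cast_lt] at hlt
  obtain ⟨r, x, Z, hq⟩ := exists_linearQuotients h
  have hR := fun (e : ℕ) (he : e < n) =>
    subsingleton_ext_quotient_maximal m.asIdeal m.isMaximal he
  refine not_nontrivial_iff_subsingleton.mpr ?_ hd
  refine subsingleton_ext_of_surjective _ d (Submodule.mkQ_surjective I) (hR d (by omega)) ?_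
  rw [Submodule.ker_mkQ]
  exact subsingleton_ext_of_linearQuotients _ hR hq (by omega)

end Depth

end InitReg

/-! ### The main theorem -/

theorem theorem3p10 {k : Type*} [Field k] {n : ℕ}
    (I : Ideal (MvPolynomial (Fin n) k)) (hI : I ≠ ⊤)
    (ord₁ : MonomialOrder (Fin n))
    (q : ℕ) (t : Fin q → ℕ) (b : (i : Fin q) → Fin (t i + 1) → Fin n)
    (hb : Function.Injective (fun p : (i : Fin q) × Fin (t i + 1) => b p.1 p.2))
    (h₁ : ∀ (i : Fin q) (j : Fin (t i + 1)), j ≠ 0 →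
      InitReg.varDegree (b i j) (InitReg.ini ord₁ I) ≤ 1)
    (h₂ : ∀ i : Fin q, ∀ a ∈ InitReg.minGens (InitReg.ini ord₁ I), a (b i 0) ≠ 0 →
      ∃ j : Fin (t i + 1), j ≠ 0 ∧ a (b i j) ≠ 0) :
    (∀ ord : Fin q → MonomialOrder (Fin n),
      (∀ h : 0 < q, ord ⟨0, h⟩ = ord₁) →
      (∀ (i : ℕ) (h : i + 1 < q) (j : Fin (t ⟨i, Nat.lt_of_succ_lt h⟩ + 1)), j ≠ 0 →
        Finsupp.single (b ⟨i, Nat.lt_of_succ_lt h⟩ j) 1 ≺[ord ⟨i + 1, h⟩]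
          Finsupp.single (b ⟨i, Nat.lt_of_succ_lt h⟩ 0) 1) →
      InitReg.IsInitiallyRegular ord
        (fun i => ∑ j : Fin (t i + 1), (MvPolynomial.X (b i j) : MvPolynomial (Fin n) k)) I) ∧
    (q : ℕ∞) ≤ InitReg.depth (MvPolynomial (Fin n) k) (MvPolynomial (Fin n) k ⧸ I) := by
  classical
  set S : Fin q → Finset (Fin n) := fun i =>
    Finset.univ.image fun j : Fin (t i) => b i j.succ with hS
  have hb' : ∀ {i i' : Fin q} {j : Fin (t i + 1)} {j' : Fin (t i' + 1)}, b i j = b i' j' →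
      (⟨i, j⟩ : (i : Fin q) × Fin (t i + 1)) = ⟨i', j'⟩ := fun h => hb h
  have hinj : ∀ i, Function.Injective (b i) := fun i j j' h => by simpa using hb' h
  have hxx : Function.Injective fun i => b i 0 := fun i i' h => congrArg Sigma.fst (hb' h)
  have hxS : ∀ i j, b i 0 ∉ S j := by
    intro i j hij
    obtain ⟨l, -, hl⟩ := Finset.mem_image.mp hij
    have h := hb' hl
    obtain rfl : j = i := congrArg Sigma.fst h
    simp at h
  have hSS : ∀ i j, i ≠ j → Disjoint (S i) (S j) := by
    intro i j hij
    refine Finset.disjoint_left.mpr fun y hy hy' => ?_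
    obtain ⟨l, -, rfl⟩ := Finset.mem_image.mp hy
    obtain ⟨l', -, hl'⟩ := Finset.mem_image.mp hy'
    exact hij (congrArg Sigma.fst (hb' hl')).symm
  have had : ∀ i, InitReg.Adapted (b i 0) (S i)
      (InitReg.exponents (InitReg.ini ord₁ I)) := by
    refine fun i => InitReg.adapted_of_minGens (hxS i i) (fun y hy => ?_) fun a ha hax => ?_
    · obtain ⟨j, -, rfl⟩ := Finset.mem_image.mp hy
      exact h₁ i _ (Fin.succ_ne_zero j)
    · obtain ⟨j, hj, haj⟩ := h₂ i a ha hax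
      obtain ⟨l, rfl⟩ := Fin.exists_succ_eq.mpr hj
      exact ⟨_, Finset.mem_image_of_mem _ (Finset.mem_univ l), haj⟩
  refine ⟨fun ord hord _ => ?_, ?_⟩
  · have hf : (fun i => ∑ j : Fin (t i + 1), (MvPolynomial.X (b i j) : MvPolynomial (Fin n) k)) =
        fun i => MvPolynomial.X (b i 0) + ∑ y ∈ S i, MvPolynomial.X y := by
      funext i
      rw [Fin.sum_univ_succ, hS, Finset.sum_image fun j _ l _ h =>
        Fin.succ_injective _ (hinj i h)]
    rw [hf]
    exact InitReg.isInitiallyRegular_of_adapted hxx hxS hSS hI ord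
      fun hq i => (hord hq).symm ▸ had i
  · have hqn : q ≤ n := by simpa using Fintype.card_le_of_injective _ hxx
    have hup : IsUpperSet (InitReg.exponents (InitReg.ini ord₁ I)) := fun _ _ hac ha => by
      exact InitReg.monomial_mem_of_le (J := InitReg.ini ord₁ I) hac ha
    obtain ⟨N, hN⟩ := InitReg.exists_boundedAt hup
    -- All n variables and all q groups are used, so the count n = s + q gives s = n - q.
    refine InitReg.le_depth_of_hasLinearQuotients (s := n - q) (by omega)
      (InitReg.hasLinearQuotients_of_adapted (x := fun i => b i 0) Finset.univ
        (G := Finset.univ) (T := S) hup ?_ hN (by simp) (by simpa using by omega) (by simp)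
        (by simp) hxx.injOn (fun i _ j _ => hxS i j) (fun i _ j _ => hSS i j) fun i _ => had i)
    exact fun h0 => InitReg.ini_ne_top hI ((Ideal.eq_top_iff_one _).mpr h0)
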